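/- For every real $\epsilon>0$ there are $p\in\mathbb{N}$ and an algorithm $A_\epsilon$ with the following property. Let $k,n\geq 1$ and let ${\cal F}=\{F_1,\ldots,F_k\}$ consist of $k$ (finite, simple) forests of order at most $n$, each given by its adjacency matrix. Call a forest $F$ a subforest of ${\cal F}$ if every $F_i$ has an induced subgraph isomorphic to $F$, call a subforest of ${\cal F}$ maximum if it has maximum order among all subforests of ${\cal F}$, and let $n(F)$ denote the order of $F$. Given ${\cal F}$, the algorithm $A_\epsilon$ determines, in time $O(k\,n^p)$, a subforest $F$ of ${\cal F}$ with $$n(F)\geq (1-\epsilon)\,n(F_{\rm opt}),$$ where $F_{\rm opt}$ is some maximum subforest of ${\cal F}$. The constant hidden in the $O$ depends only on $\epsilon$. Time is the number of elementary operations of a WHILE program on binary trees of cons cells (unit cost for reading or assigning a variable, creating a cell, following a pointer, testing for nil; no arithmetic). In particular, Maximum Subforest has a polynomial time approximation scheme. -/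

import Mathlib

/-! ### Finite graphs, common induced subforests -/

/-- A finite simple graph, with vertex set `{0, …, order - 1}`. -/
structure FinGraph where
  /-- the number of vertices -/
  order : ℕ
  /-- the graph itself -/
  graph : SimpleGraph (Fin order)

/-- `H` is a subforest of the family `Fs`: it is a forest, and every member of `Fs` has an induced
subgraph that is isomorphic to `H` (`H.graph ⊴ F.graph`). -/
def IsSubforest (Fs : List FinGraph) (H : FinGraph) : Prop :=
  H.graph.IsAcyclic ∧ ∀ F ∈ Fs, H.graph.IsIndContained F.graph

/-- `H` is a subforest of `Fs` of maximum order. -/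
def IsMaximumSubforest (Fs : List FinGraph) (H : FinGraph) : Prop :=
  IsSubforest Fs H ∧ ∀ H' : FinGraph, IsSubforest Fs H' → H'.order ≤ H.order

/-! ### The machine model

Imperative WHILE programs whose variables hold (pointers to) immutable binary trees built from cons
cells. Each elementary operation (reading a variable, producing `nil`, allocating one cell,
following one pointer out of a cell, testing for `nil`, assigning a pointer) costs one time unit;
there is no arithmetic and no comparison of trees in a single step. Every time unit can
thus be executed in constant time on a pointer machine or on a random access machine. -/

/-- The data of the machine: binary trees of cons cells. -/
inductive ConsTree where
  | nil : ConsTree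
  | cons : ConsTree → ConsTree → ConsTree

namespace ConsTree

/-- First component of a cell (`nil` if there is no cell). -/
def hd : ConsTree → ConsTree
  | nil => nil
  | cons a _ => a

/-- Second component of a cell (`nil` if there is no cell). -/
def tl : ConsTree → ConsTree
  | nil => nil
  | cons _ b => b

/-- A bit as a tree. -/
def ofBool : Bool → ConsTree
  | false => nil
  | true => cons nil nil

/-- A list of trees as a tree. -/
def ofList : List ConsTree → ConsTree
  | [] => nil
  | a :: l => cons a (ofList l)

end ConsTree

/-- Contents of the variables; the variables are numbered `0, 1, 2, …`, and a program mentions only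
finitely many of them. -/
abbrev WhileStore := ℕ → ConsTree

/-- Expressions of WHILE programs. -/
inductive WhileExpr where
  | var : ℕ → WhileExpr
  | nil : WhileExpr
  | cons : WhileExpr → WhileExpr → WhileExpr
  | hd : WhileExpr → WhileExpr
  | tl : WhileExpr → WhileExpr

namespace WhileExpr

/-- The value of an expression. -/
def eval (s : WhileStore) : WhileExpr → ConsTree
  | var x => s x
  | nil => ConsTree.nil
  | cons a b => ConsTree.cons (a.eval s) (b.eval s)
  | hd a => (a.eval s).hd
  | tl a => (a.eval s).tl

/-- The cost of evaluating an expression: its number of operations. -/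
def cost : WhileExpr → ℕ
  | var _ => 1
  | nil => 1
  | cons a b => a.cost + b.cost + 1
  | hd a => a.cost + 1
  | tl a => a.cost + 1

end WhileExpr

/-- WHILE programs. -/
inductive WhileCmd where
  /-- do nothing -/
  | skip : WhileCmd
  /-- `x := e` -/
  | assign (x : ℕ) (e : WhileExpr) : WhileCmd
  /-- first `c`, then `d` -/
  | seq (c d : WhileCmd) : WhileCmd
  /-- if the value of `e` is not `nil` then `c` else `d` -/
  | cond (e : WhileExpr) (c d : WhileCmd) : WhileCmd
  /-- while the value of `e` is not `nil` do `c` -/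
  | loop (e : WhileExpr) (c : WhileCmd) : WhileCmd

namespace WhileCmd

/-- `Runs c s s' t`: started with store `s`, the program `c` halts with store `s'` after exactly
`t` time units. -/
inductive Runs : WhileCmd → WhileStore → WhileStore → ℕ → Prop
  | skip (s : WhileStore) : Runs skip s s 1
  | assign (x : ℕ) (e : WhileExpr) (s : WhileStore) :
      Runs (assign x e) s (Function.update s x (e.eval s)) (e.cost + 1)
  | seq {c d : WhileCmd} {s s' s'' : WhileStore} {t u : ℕ}
      (hc : Runs c s s' t) (hd : Runs d s' s'' u) : Runs (seq c d) s s'' (t + u)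
  | cond_then {e : WhileExpr} {c d : WhileCmd} {s s' : WhileStore} {t : ℕ}
      (he : e.eval s ≠ ConsTree.nil) (hc : Runs c s s' t) :
      Runs (cond e c d) s s' (e.cost + 1 + t)
  | cond_else {e : WhileExpr} {c d : WhileCmd} {s s' : WhileStore} {t : ℕ}
      (he : e.eval s = ConsTree.nil) (hd : Runs d s s' t) :
      Runs (cond e c d) s s' (e.cost + 1 + t)
  | loop_done {e : WhileExpr} {c : WhileCmd} {s : WhileStore}
      (he : e.eval s = ConsTree.nil) : Runs (loop e c) s s (e.cost + 1)
  | loop_step {e : WhileExpr} {c : WhileCmd} {s s' s'' : WhileStore} {t u : ℕ}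
      (he : e.eval s ≠ ConsTree.nil) (hc : Runs c s s' t) (hl : Runs (loop e c) s' s'' u) :
      Runs (loop e c) s s'' (e.cost + 1 + t + u)

/-- The machine is deterministic: the final store and the running time are determined by the
program and the initial store. -/
theorem Runs.deterministic {c : WhileCmd} {s s₁ s₂ : WhileStore} {t₁ t₂ : ℕ}
    (h₁ : Runs c s s₁ t₁) (h₂ : Runs c s s₂ t₂) : s₁ = s₂ ∧ t₁ = t₂ := by
  induction h₁ generalizing s₂ t₂ with
  | skip s => cases h₂; exact ⟨rfl, rfl⟩
  | assign x e s => cases h₂; exact ⟨rfl, rfl⟩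
  | seq _ _ ihc ihd =>
    cases h₂ with
    | seq hc hd =>
      obtain ⟨rfl, rfl⟩ := ihc hc
      obtain ⟨rfl, rfl⟩ := ihd hd
      exact ⟨rfl, rfl⟩
  | cond_then he _ ih =>
    cases h₂ with
    | cond_then _ hc => obtain ⟨rfl, rfl⟩ := ih hc; exact ⟨rfl, rfl⟩
    | cond_else he' _ => exact absurd he' he
  | cond_else he _ ih =>
    cases h₂ with
    | cond_then he' _ => exact absurd he he'
    | cond_else _ hd => obtain ⟨rfl, rfl⟩ := ih hd; exact ⟨rfl, rfl⟩
  | loop_done he =>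
    cases h₂ with
    | loop_done _ => exact ⟨rfl, rfl⟩
    | loop_step he' _ _ => exact absurd he he'
  | loop_step he _ _ ihc ihl =>
    cases h₂ with
    | loop_done he' => exact absurd he' he
    | loop_step _ hc hl =>
      obtain ⟨rfl, rfl⟩ := ihc hc
      obtain ⟨rfl, rfl⟩ := ihl hl
      exact ⟨rfl, rfl⟩

/-- The initial store for input `x`: variable `0` holds `x`, all other variables hold `nil`. -/
def initStore (x : ConsTree) : WhileStore :=
  Function.update (fun _ => ConsTree.nil) 0 x

/-- On input `x`, the program `P` halts after exactly `t` time units with output `y`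
(in variable `0`). -/
def OutputsIn (P : WhileCmd) (x y : ConsTree) (t : ℕ) : Prop :=
  ∃ s : WhileStore, Runs P (initStore x) s t ∧ s 0 = y

end WhileCmd

/-! ### Encoding of graphs -/

open Classical in
/-- A graph is represented by its adjacency matrix, as the list of its rows. -/
noncomputable def FinGraph.encode (G : FinGraph) : ConsTree :=
  ConsTree.ofList (List.ofFn fun i : Fin G.order =>
    ConsTree.ofList (List.ofFn fun j : Fin G.order =>
      ConsTree.ofBool (decide (G.graph.Adj i j))))

/-- A list of graphs is represented by the list of their representations. -/
noncomputable def encodeGraphs (Fs : List FinGraph) : ConsTree :=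
  ConsTree.ofList (Fs.map FinGraph.encode)

/-! Choose `c ≥ 1` with `ε (c + 1) ≥ 1`. The approximation rests on a fact about a single forest:
deleting at most the fraction `1 / (c + 1)` of its vertices suffices to leave only components of
order at most `c` (`exists_pack`). Applied to a maximum subforest, it yields a common induced
subforest with such small components whose order is at least `c / (c + 1) ≥ 1 - ε` times the
optimum. It therefore suffices to find a largest subforest among those with components of order at
most `c`.

Up to isomorphism, a forest of this kind is a vector of multiplicities, indexed by the finitely many
isomorphism types of trees of order at most `c`. As `c` is constant, there are only polynomially
many vectors with entries at most `n`, and those realized by induced subgraphs of one forest can be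
tabulated (`feasible`; sound by `exists_pack_of_mem_feasible`, complete by `multVec_mem_feasible`).
The tables are intersected over the family (`restrict`), and a vector with the largest number of
vertices is turned back into a graph (`outGraph`).

The cutting fact and the tables come from the same elimination (`elim_correct`): a vertex with at
most one remaining neighbour is merged into that neighbour, again and again. Each remaining vertex
is the root of a bag of merged vertices, and all edges between bags join roots. A property of bag,
root and value that holds for singletons and for the empty set, and that survives linking two bags
at their roots, thus holds for the whole forest in the end. For cutting, the property is a charging
inequality. For the tables it is `TableSpec`, where an entry records the shape of the tree at the
root and the multiplicities of the other trees.

For the running time, `PolyTime` is closed under the usual list operations, and whatever depends on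
`c` alone, even if obtained by choice, is hardwired by finite case distinctions (`FinCase`). Only
the outer loop over the family is timed by hand: its accumulator never outgrows the first table, so
each of the `k` rounds costs a polynomial in `n` (`exists_program`). -/

namespace MaxSubforest

open WhileCmd

/-! ### Programs computing functions on encoded data -/

/-- Types whose elements are represented by trees of cons cells. -/
class TreeCode (α : Type) where
  /-- the representation -/
  code : α → ConsTree

open TreeCode

/-- The number of nodes of a tree, counting empty leaves. -/
def treeSize : ConsTree → ℕ
  | .nil => 1
  | .cons a b => treeSize a + treeSize b + 1

theorem treeSize_pos (x : ConsTree) : 1 ≤ treeSize x := by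
  cases x <;> simp [treeSize]

/-- The size of the representation. -/
def tsize {α : Type} [TreeCode α] (a : α) : ℕ := treeSize (code a)

theorem tsize_pos {α : Type} [TreeCode α] (a : α) : 1 ≤ tsize a := treeSize_pos _

instance : TreeCode Unit := ⟨fun _ => .nil⟩

instance : TreeCode Bool := ⟨ConsTree.ofBool⟩

instance {α β : Type} [TreeCode α] [TreeCode β] : TreeCode (α × β) :=
  ⟨fun p => .cons (code p.1) (code p.2)⟩

instance {α : Type} [TreeCode α] : TreeCode (List α) :=
  ⟨fun l => ConsTree.ofList (l.map code)⟩

instance : TreeCode ℕ := ⟨fun n => code (List.replicate n ())⟩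

instance {α : Type} [TreeCode α] : TreeCode (Option α) := ⟨fun o => code o.toList⟩

instance {n : ℕ} : TreeCode (Fin n) := ⟨fun i => code i.val⟩

section basics

variable {α β γ σ : Type} [TreeCode α] [TreeCode β] [TreeCode γ] [TreeCode σ]

theorem code_pair (a : α) (b : β) : code (a, b) = .cons (code a) (code b) := rfl

theorem code_cons (a : α) (l : List α) : code (a :: l) = .cons (code a) (code l) := rfl

@[simp] theorem tsize_pair (a : α) (b : β) : tsize (a, b) = tsize a + tsize b + 1 := rfl

@[simp] theorem tsize_nil : tsize ([] : List α) = 1 := rfl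

@[simp] theorem tsize_cons (a : α) (l : List α) : tsize (a :: l) = tsize a + tsize l + 1 := rfl

theorem tsize_list (l : List α) : tsize l = (l.map fun a => tsize a + 1).sum + 1 := by
  induction l with
  | nil => rfl
  | cons a l ih => simp [ih]; omega

theorem length_le_tsize (l : List α) : l.length ≤ tsize l := by
  induction l with
  | nil => simp
  | cons a l ih => simp; omega

theorem tsize_le_of_mem {a : α} {l : List α} (h : a ∈ l) : tsize a ≤ tsize l := by
  induction l with
  | nil => simp at h
  | cons b l ih =>
    rcases List.mem_cons.1 h with rfl | h
    · simp; omega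
    · have := ih h; simp; omega

theorem tsize_le_of_sublist {l₁ l₂ : List α} (h : l₁.Sublist l₂) : tsize l₁ ≤ tsize l₂ := by
  induction h with
  | slnil => simp
  | cons a _ ih => simp; omega
  | cons_cons a _ ih => simp; omega

theorem tsize_list_le {l : List α} {B : ℕ} (h : ∀ a ∈ l, tsize a ≤ B) :
    tsize l ≤ l.length * (B + 1) + 1 := by
  induction l with
  | nil => simp
  | cons a l ih =>
    have h1 := ih fun x hx => h x (List.mem_cons_of_mem _ hx)
    have h2 := h a (List.mem_cons_self ..)
    simp only [tsize_cons, List.length_cons, Nat.add_mul]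
    omega

theorem tsize_append (l₁ l₂ : List α) : tsize (l₁ ++ l₂) + 1 = tsize l₁ + tsize l₂ := by
  induction l₁ with
  | nil => simp; omega
  | cons a l ih => simp; omega

theorem tsize_reverse (l : List α) : tsize l.reverse = tsize l := by
  simp [tsize_list, List.sum_reverse]

theorem tsize_nat (n : ℕ) : tsize n = 2 * n + 1 := by
  induction n with
  | zero => rfl
  | succ n ih =>
    have : tsize (n + 1) = 1 + tsize n + 1 := rfl
    omega

theorem tsize_bool_le (b : Bool) : tsize b ≤ 3 := by cases b <;> decide

/-! ### Composition of programs with time bounds -/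

/-- `P` computes `f` in time at most `T`, taking its argument from and leaving its value in
variable `0`, whatever the other variables contain. -/
def Computes (P : WhileCmd) (f : α → β) (T : α → ℕ) : Prop :=
  ∀ (a : α) (s : WhileStore), s 0 = code a →
    ∃ s' t, Runs P s s' t ∧ s' 0 = code (f a) ∧ t ≤ T a

theorem Computes.comp {P Q : WhileCmd} {f : α → β} {g : β → γ} {T : α → ℕ} {U : β → ℕ}
    (hP : Computes P f T) (hQ : Computes Q g U) :
    Computes (.seq P Q) (fun a => g (f a)) (fun a => T a + U (f a)) := by
  intro a s hs
  obtain ⟨s₁, t₁, h₁, e₁, b₁⟩ := hP a s hs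
  obtain ⟨s₂, t₂, h₂, e₂, b₂⟩ := hQ (f a) s₁ e₁
  exact ⟨s₂, t₁ + t₂, .seq h₁ h₂, e₂, add_le_add b₁ b₂⟩

theorem Computes.mono {P : WhileCmd} {f : α → β} {T U : α → ℕ} (hP : Computes P f T)
    (h : ∀ a, T a ≤ U a) : Computes P f U := by
  intro a s hs
  obtain ⟨s₁, t₁, h₁, e₁, b₁⟩ := hP a s hs
  exact ⟨s₁, t₁, h₁, e₁, b₁.trans (h a)⟩

theorem Computes.ofExpr {f : α → β} (e : WhileExpr)
    (h : ∀ a (s : WhileStore), s 0 = code a → e.eval s = code (f a)) :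
    Computes (.assign 0 e) f (fun _ => e.cost + 1) := by
  intro a s hs
  exact ⟨_, _, .assign 0 e s, by simp [h a s hs], le_rfl⟩

/-! ### Shifting the variables of a program -/

/-- Add `m` to the numbers of all variables of an expression. -/
def shiftExpr (m : ℕ) : WhileExpr → WhileExpr
  | .var x => .var (x + m)
  | .nil => .nil
  | .cons a b => .cons (shiftExpr m a) (shiftExpr m b)
  | .hd a => .hd (shiftExpr m a)
  | .tl a => .tl (shiftExpr m a)

/-- Add `m` to the numbers of all variables of a program. -/
def shift (m : ℕ) : WhileCmd → WhileCmd
  | .skip => .skip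
  | .assign x e => .assign (x + m) (shiftExpr m e)
  | .seq c d => .seq (shift m c) (shift m d)
  | .cond e c d => .cond (shiftExpr m e) (shift m c) (shift m d)
  | .loop e c => .loop (shiftExpr m e) (shift m c)

/-- The store that agrees with `s` below `m` and with the translate of `s'` from `m` on. -/
def glue (m : ℕ) (s s' : WhileStore) : WhileStore := fun i => if i < m then s i else s' (i - m)

theorem eval_shiftExpr (m : ℕ) (s s' : WhileStore) (e : WhileExpr) :
    (shiftExpr m e).eval (glue m s s') = e.eval s' := by
  induction e with
  | var x => simp [shiftExpr, WhileExpr.eval, glue]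
  | nil => rfl
  | cons a b iha ihb => simp [shiftExpr, WhileExpr.eval, iha, ihb]
  | hd a ih => simp [shiftExpr, WhileExpr.eval, ih]
  | tl a ih => simp [shiftExpr, WhileExpr.eval, ih]

theorem cost_shiftExpr (m : ℕ) (e : WhileExpr) : (shiftExpr m e).cost = e.cost := by
  induction e <;> simp_all [shiftExpr, WhileExpr.cost]

theorem glue_update (m : ℕ) (s s' : WhileStore) (x : ℕ) (v : ConsTree) :
    Function.update (glue m s s') (x + m) v = glue m s (Function.update s' x v) := by
  funext i
  by_cases h : i = x + m
  · subst h; simp [glue]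
  · rw [Function.update_of_ne h]
    unfold glue
    split_ifs with hi
    · rfl
    · rw [Function.update_of_ne]; omega

/-- A translated program neither reads nor writes the variables below `m`, so the caller can keep
data there. -/
theorem Runs.shift {m : ℕ} {s : WhileStore} {P : WhileCmd} {s₁ s₂ : WhileStore} {t : ℕ}
    (h : Runs P s₁ s₂ t) : Runs (shift m P) (glue m s s₁) (glue m s s₂) t := by
  induction h with
  | skip s => exact .skip _
  | assign x e s₁ =>
    have := Runs.assign (x + m) (shiftExpr m e) (glue m s s₁)
    rwa [eval_shiftExpr, glue_update, cost_shiftExpr] at this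
  | seq _ _ ih₁ ih₂ => exact .seq ih₁ ih₂
  | cond_then he _ ih =>
    rw [← cost_shiftExpr m]
    exact .cond_then (by rwa [eval_shiftExpr]) ih
  | cond_else he _ ih =>
    rw [← cost_shiftExpr m]
    exact .cond_else (by rwa [eval_shiftExpr]) ih
  | loop_done he =>
    rw [← cost_shiftExpr m]
    exact .loop_done (by rwa [eval_shiftExpr])
  | loop_step he _ _ ih₁ ih₂ =>
    rw [← cost_shiftExpr m]
    exact .loop_step (by rwa [eval_shiftExpr]) ih₁ ih₂

/-- A subroutine call: the argument is taken from variable `m`, the value is left there, and the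
variables below `m` are preserved. -/
theorem Computes.call {P : WhileCmd} {f : α → β} {T : α → ℕ} (hP : Computes P f T) (m : ℕ)
    {a : α} {s : WhileStore} (hs : s m = code a) :
    ∃ s' t, Runs (shift m P) s s' t ∧ s' m = code (f a) ∧ (∀ i < m, s' i = s i) ∧ t ≤ T a := by
  obtain ⟨s₁, t, h, e, b⟩ := hP a (fun i => s (i + m)) (by simpa using hs)
  -- Every store is glued from its part below `m` and its own translate, so the translated run is a
  -- run from `s` itself.
  have hg : glue m s (fun i => s (i + m)) = s := by
    funext i
    unfold glue
    split_ifs with hi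
    · rfl
    · simp [Nat.sub_add_cancel (Nat.le_of_not_lt hi)]
  refine ⟨glue m s s₁, t, ?_, ?_, ?_, b⟩
  · have := Runs.shift (m := m) (s := s) h
    rwa [hg] at this
  · simp [glue, e]
  · intro i hi
    simp [glue, hi]

/-- Pairing of two programs. -/
def pairCmd (P Q : WhileCmd) : WhileCmd :=
  .seq (.assign 1 (.var 0)) (.seq (shift 1 P) (.seq (.assign 2 (.var 0)) (.seq (shift 2 Q)
    (.assign 0 (.cons (.var 1) (.var 2))))))

/-- The first result is parked below the variables of the second call. Copying the argument only
copies a pointer, so the overhead 8 does not depend on its size. -/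
theorem Computes.pair {P Q : WhileCmd} {f : α → β} {g : α → γ} {T U : α → ℕ}
    (hP : Computes P f T) (hQ : Computes Q g U) :
    Computes (pairCmd P Q) (fun a => (f a, g a)) (fun a => T a + U a + 8) := by
  intro a s hs
  obtain ⟨s₁, t₁, h₁, e₁, f₁, b₁⟩ := hP.call 1 (a := a) (s := Function.update s 1 (s 0)) (by simpa)
  have e₀ : s₁ 0 = code a := by rw [f₁ 0 (by omega)]; simpa
  obtain ⟨s₂, t₂, h₂, e₂, f₂, b₂⟩ := hQ.call 2 (a := a) (s := Function.update s₁ 2 (s₁ 0))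
    (by simpa)
  refine ⟨_, _, .seq (.assign _ _ _) (.seq h₁ (.seq (.assign _ _ _) (.seq h₂ (.assign _ _ _)))),
    ?_, ?_⟩
  · simp only [Function.update_self, WhileExpr.eval, code_pair, e₂]
    rw [f₂ 1 (by omega), Function.update_of_ne (by omega), e₁]
  · simp only [WhileExpr.cost]; omega

/-- Branching on the value of a program. -/
def iteCmd (R P Q : WhileCmd) : WhileCmd :=
  .seq (.assign 1 (.var 0)) (.seq (shift 1 R) (.cond (.var 1) P Q))

theorem Computes.ite {R P Q : WhileCmd} {c : α → Bool} {f g : α → β} {T U V : α → ℕ}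
    (hR : Computes R c T) (hP : Computes P f U) (hQ : Computes Q g V) :
    Computes (iteCmd R P Q) (fun a => if c a then f a else g a)
      (fun a => T a + U a + V a + 4) := by
  intro a s hs
  obtain ⟨s₁, t₁, h₁, e₁, f₁, b₁⟩ := hR.call 1 (a := a) (s := Function.update s 1 (s 0)) (by simpa)
  have e₀ : s₁ 0 = code a := by rw [f₁ 0 (by omega)]; simpa
  by_cases hc : c a = true
  · obtain ⟨s₂, t₂, h₂, e₂, b₂⟩ := hP a s₁ e₀
    refine ⟨s₂, _, .seq (.assign _ _ _) (.seq h₁ (.cond_then ?_ h₂)), by simpa [hc], ?_⟩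
    · simp only [WhileExpr.eval, e₁, hc]; intro h; cases h
    · simp only [WhileExpr.cost]; omega
  · obtain ⟨s₂, t₂, h₂, e₂, b₂⟩ := hQ a s₁ e₀
    refine ⟨s₂, _, .seq (.assign _ _ _) (.seq h₁ (.cond_else ?_ h₂)), by simpa [hc], ?_⟩
    · simp only [WhileExpr.eval, e₁, hc]; rfl
    · simp only [WhileExpr.cost]; omega

/-- Test for the empty tree. -/
def testCmd : WhileCmd := .cond (.var 0) (.assign 0 (.cons .nil .nil)) (.assign 0 .nil)

theorem Computes.test {c : α → Bool} (h : ∀ a, code a = .nil ↔ c a = false) :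
    Computes testCmd c (fun _ => 6) := by
  intro a s hs
  by_cases ha : code a = .nil
  · refine ⟨_, _, .cond_else ?_ (.assign _ _ _), ?_, ?_⟩
    · simpa [WhileExpr.eval, hs] using ha
    · rw [(h a).1 ha]; simp [WhileExpr.eval]; rfl
    · simp [WhileExpr.cost]
  · refine ⟨_, _, .cond_then ?_ (.assign _ _ _), ?_, ?_⟩
    · simpa [WhileExpr.eval, hs] using ha
    · have : c a = true := by
        by_contra hc; exact ha ((h a).2 (by simpa using hc))
      rw [this]; simp [WhileExpr.eval]; rfl
    · simp [WhileExpr.cost]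

/-- The body of a loop over a list: variable `0` holds the context, variable `1` the rest of the
list, and variable `2` the accumulator. -/
def foldBody (P : WhileCmd) : WhileCmd :=
  .seq (.assign 3 (.cons (.var 0) (.cons (.var 2) (.hd (.var 1))))) (.seq (shift 3 P)
    (.seq (.assign 2 (.var 3)) (.assign 1 (.tl (.var 1)))))

/-- A loop over a list. -/
def foldCmd (P : WhileCmd) : WhileCmd :=
  .seq (.assign 1 (.tl (.tl (.var 0)))) (.seq (.assign 2 (.hd (.tl (.var 0))))
    (.seq (.assign 0 (.hd (.var 0))) (.seq (.loop (.var 1) (foldBody P)) (.assign 0 (.var 2)))))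

/-- A round is timed only at accumulators that really occur, those reached after a prefix of the
list; their size can then be controlled separately. The overhead of a round is 14, so 20 is
generous. -/
theorem fold_loop_runs {P : WhileCmd} {h : γ → σ → β → σ} {T : γ × σ × β → ℕ}
    (hP : Computes P (fun q : γ × σ × β => h q.1 q.2.1 q.2.2) T) (c : γ) (τ : ℕ) (l : List β) :
    ∀ (z : σ), (∀ l₁ b l₂, l = l₁ ++ b :: l₂ → T (c, l₁.foldl (h c) z, b) ≤ τ) →
    ∀ s : WhileStore, s 0 = code c → s 1 = code l → s 2 = code z →
    ∃ s' t, Runs (.loop (.var 1) (foldBody P)) s s' t ∧ s' 2 = code (l.foldl (h c) z) ∧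
      t ≤ 2 + l.length * (τ + 20) := by
  induction l with
  | nil =>
    intro z _ s _ h1 h2
    exact ⟨s, _, .loop_done h1, h2, by simp [WhileExpr.cost]⟩
  | cons b l ih =>
    intro z hτ s h0 h1 h2
    obtain ⟨s₁, t₁, r₁, e₁, f₁, b₁⟩ := hP.call 3 (a := (c, z, b))
      (s := Function.update s 3 ((WhileExpr.cons (.var 0) (.cons (.var 2) (.hd (.var 1)))).eval s))
      (by simp [WhileExpr.eval, h0, h1, h2, code_pair, code_cons, ConsTree.hd])
    have hb := hτ [] b l rfl
    obtain ⟨s₂, t₂, r₂, e₂, b₂⟩ := ih (h c z b)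
      (fun l₁ b' l₂ e => hτ (b :: l₁) b' l₂ (by rw [e]; rfl))
      (Function.update (Function.update s₁ 2 (s₁ 3)) 1
        ((WhileExpr.tl (.var 1)).eval (Function.update s₁ 2 (s₁ 3))))
      (by simp [f₁ 0, h0]) (by simp [WhileExpr.eval, f₁ 1, h1, code_cons, ConsTree.tl])
      (by simp [e₁])
    refine ⟨s₂, _, .loop_step ?_ (.seq (.assign _ _ _) (.seq r₁ (.seq (.assign _ _ _)
      (.assign _ _ _)))) r₂, e₂, ?_⟩
    · simp only [WhileExpr.eval, h1, code_cons]; intro h; cases h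
    · simp only [WhileExpr.cost, List.length_cons, Nat.add_mul]
      simp only [List.foldl_nil] at hb
      omega

theorem foldCmd_runs {P : WhileCmd} {h : γ → σ → β → σ} {T : γ × σ × β → ℕ}
    (hP : Computes P (fun q : γ × σ × β => h q.1 q.2.1 q.2.2) T) (c : γ) (z : σ) (l : List β)
    (τ : ℕ) (hτ : ∀ l₁ b l₂, l = l₁ ++ b :: l₂ → T (c, l₁.foldl (h c) z, b) ≤ τ)
    (s : WhileStore) (hs : s 0 = code (c, z, l)) :
    ∃ s' t, Runs (foldCmd P) s s' t ∧ s' 0 = code (l.foldl (h c) z) ∧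
      t ≤ 20 + l.length * (τ + 20) := by
  obtain ⟨s₁, t₁, r₁, e₁, b₁⟩ := fold_loop_runs hP c τ l z hτ
    (Function.update (Function.update (Function.update s 1 (code l)) 2 (code z)) 0 (code c))
    (by simp) (by simp) (by simp)
  refine ⟨_, _, .seq (.assign _ _ _) (.seq (.assign _ _ _) (.seq (.assign _ _ _)
    (.seq (s' := s₁) (t := t₁) ?_ (.assign _ _ _)))), by simpa [WhileExpr.eval] using e₁, ?_⟩
  · convert r₁ using 2 <;> simp [WhileExpr.eval, hs, code_pair, ConsTree.hd, ConsTree.tl]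
  · simp only [WhileExpr.cost]; omega

/-! ### Polynomial bounds -/

/-- `g` is bounded by a polynomial in the size of the argument. -/
def PolyBdd (g : α → ℕ) : Prop := ∃ C p, ∀ a, g a ≤ C * tsize a ^ p

theorem PolyBdd.mono {g g' : α → ℕ} (h : PolyBdd g') (hg : ∀ a, g a ≤ g' a) : PolyBdd g := by
  obtain ⟨C, p, h⟩ := h
  exact ⟨C, p, fun a => (hg a).trans (h a)⟩

theorem PolyBdd.const (C : ℕ) : PolyBdd (fun _ : α => C) := ⟨C, 0, by simp⟩

theorem PolyBdd.size : PolyBdd (fun a : α => tsize a) := ⟨1, 1, by simp⟩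

theorem PolyBdd.add {g h : α → ℕ} (hg : PolyBdd g) (hh : PolyBdd h) :
    PolyBdd (fun a => g a + h a) := by
  obtain ⟨C, p, hg⟩ := hg
  obtain ⟨D, q, hh⟩ := hh
  refine ⟨C + D, p + q, fun a => ?_⟩
  have h1 : tsize a ^ p ≤ tsize a ^ (p + q) := Nat.pow_le_pow_right (tsize_pos a) (by omega)
  have h2 : tsize a ^ q ≤ tsize a ^ (p + q) := Nat.pow_le_pow_right (tsize_pos a) (by omega)
  calc g a + h a ≤ C * tsize a ^ p + D * tsize a ^ q := add_le_add (hg a) (hh a)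
    _ ≤ C * tsize a ^ (p + q) + D * tsize a ^ (p + q) := by gcongr
    _ = _ := by ring

theorem PolyBdd.mul {g h : α → ℕ} (hg : PolyBdd g) (hh : PolyBdd h) :
    PolyBdd (fun a => g a * h a) := by
  obtain ⟨C, p, hg⟩ := hg
  obtain ⟨D, q, hh⟩ := hh
  refine ⟨C * D, p + q, fun a => ?_⟩
  calc g a * h a ≤ (C * tsize a ^ p) * (D * tsize a ^ q) := Nat.mul_le_mul (hg a) (hh a)
    _ = _ := by ring

theorem PolyBdd.pow {g : α → ℕ} (hg : PolyBdd g) (n : ℕ) : PolyBdd (fun a => g a ^ n) := by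
  induction n with
  | zero => simpa using PolyBdd.const 1
  | succ n ih => simpa [pow_succ] using ih.mul hg

theorem PolyBdd.comp {g : β → ℕ} {f : α → β} (hg : PolyBdd g)
    (hf : PolyBdd (fun a => tsize (f a))) : PolyBdd (fun a => g (f a)) := by
  obtain ⟨C, p, hg⟩ := hg
  exact ((PolyBdd.const C).mul (hf.pow p)).mono fun a => hg (f a)

/-! ### Functions computable in polynomial time -/

/-- `f` is computed in polynomial time and has values of polynomial size. -/
def PolyTime (f : α → β) : Prop :=
  (∃ P T, Computes P f T ∧ PolyBdd T) ∧ PolyBdd (fun a => tsize (f a))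

theorem PolyTime.size {f : α → β} (h : PolyTime f) : PolyBdd (fun a => tsize (f a)) := h.2

/-- Only the trees matter, so a change of type is free. This is how numbers, options and vectors are
handled as lists. -/
theorem PolyTime.congr {f : α → β} {g : α → γ} (h : PolyTime f) (e : ∀ a, code (f a) = code (g a)) :
    PolyTime g := by
  obtain ⟨⟨P, T, hP, hT⟩, hs⟩ := h
  refine ⟨⟨P, T, fun a s hs => ?_, hT⟩, hs.mono fun a => by simp [tsize, e]⟩
  rw [← e]; exact hP a s hs

theorem PolyTime.of_eq {f g : α → β} (h : PolyTime f) (e : ∀ a, f a = g a) : PolyTime g :=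
  (funext e : f = g) ▸ h

/-- A change of representation that does not change the tree. -/
theorem PolyTime.recode {f : α → β} (e : ∀ a, code (f a) = code a) : PolyTime f :=
  ⟨⟨.skip, _, fun a s hs => ⟨s, 1, .skip s, by rw [hs, e], le_rfl⟩, .const 1⟩,
    PolyBdd.size.mono fun a => by simp [tsize, e]⟩

theorem PolyTime.id : PolyTime (fun a : α => a) := .recode fun _ => rfl

theorem PolyTime.ofExpr {f : α → β} (e : WhileExpr)
    (h : ∀ a (s : WhileStore), s 0 = code a → e.eval s = code (f a))
    (hs : PolyBdd (fun a => tsize (f a))) : PolyTime f :=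
  ⟨⟨_, _, .ofExpr e h, .const _⟩, hs⟩

/-- The expression for a constant. -/
def constExpr : ConsTree → WhileExpr
  | .nil => .nil
  | .cons a b => .cons (constExpr a) (constExpr b)

theorem eval_constExpr (s : WhileStore) (x : ConsTree) : (constExpr x).eval s = x := by
  induction x with
  | nil => rfl
  | cons a b iha ihb => simp [constExpr, WhileExpr.eval, iha, ihb]

theorem PolyTime.const (b : β) : PolyTime (fun _ : α => b) :=
  .ofExpr (constExpr (code b)) (fun _ s _ => eval_constExpr s _) (.const _)

/-- The size bound on the intermediate value is a separate part of `PolyTime` because it does not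
follow from the time bound: by sharing, `cons x x` doubles the size of a tree at constant cost. -/
theorem PolyTime.comp {g : β → γ} {f : α → β} (hg : PolyTime g) (hf : PolyTime f) :
    PolyTime (fun a => g (f a)) := by
  obtain ⟨⟨P, T, hP, hT⟩, hs⟩ := hf
  obtain ⟨⟨Q, U, hQ, hU⟩, ht⟩ := hg
  exact ⟨⟨_, _, hP.comp hQ, hT.add (hU.comp hs)⟩, ht.comp hs⟩

theorem PolyTime.pair {f : α → β} {g : α → γ} (hf : PolyTime f) (hg : PolyTime g) :
    PolyTime (fun a => (f a, g a)) := by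
  obtain ⟨⟨P, T, hP, hT⟩, hs⟩ := hf
  obtain ⟨⟨Q, U, hQ, hU⟩, ht⟩ := hg
  exact ⟨⟨_, _, hP.pair hQ, (hT.add hU).add (.const 8)⟩, (hs.add ht).add (.const 1)⟩

theorem PolyTime.fst : PolyTime (fun p : α × β => p.1) :=
  .ofExpr (.hd (.var 0)) (fun a s h => by simp [WhileExpr.eval, h]; rfl)
    (PolyBdd.size.mono fun p => by cases p; simp; omega)

theorem PolyTime.snd : PolyTime (fun p : α × β => p.2) :=
  .ofExpr (.tl (.var 0)) (fun a s h => by simp [WhileExpr.eval, h]; rfl)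
    (PolyBdd.size.mono fun p => by cases p; simp; omega)

theorem PolyTime.ite {c : α → Bool} {f g : α → β} (hc : PolyTime c) (hf : PolyTime f)
    (hg : PolyTime g) : PolyTime (fun a => if c a then f a else g a) := by
  obtain ⟨⟨R, S, hR, hS⟩, -⟩ := hc
  obtain ⟨⟨P, T, hP, hT⟩, hs⟩ := hf
  obtain ⟨⟨Q, U, hQ, hU⟩, ht⟩ := hg
  refine ⟨⟨_, _, hR.ite hP hQ, ((hS.add hT).add hU).add (.const 4)⟩, (hs.add ht).mono fun a => ?_⟩
  dsimp only
  split_ifs <;> omega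

theorem PolyTime.test {c : α → Bool} (h : ∀ a, code a = .nil ↔ c a = false) : PolyTime c :=
  ⟨⟨_, _, .test h, .const _⟩, (PolyBdd.const 3).mono fun _ => tsize_bool_le _⟩

/-- Iterating a function of polynomial growth can lead to values of superpolynomial size. Hence the
requirement that one polynomial `B` bounds the accumulator after every prefix. -/
theorem PolyTime.foldl {l : α → List β} {g : α → σ} {h : α → σ → β → σ} {B : α → ℕ}
    (hl : PolyTime l) (hg : PolyTime g)
    (hh : PolyTime (fun q : α × σ × β => h q.1 q.2.1 q.2.2)) (hB : PolyBdd B)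
    (hbd : ∀ a l', l' <+: l a → tsize (l'.foldl (h a) (g a)) ≤ B a) :
    PolyTime (fun a => (l a).foldl (h a) (g a)) := by
  refine ⟨?_, hB.mono fun a => hbd a _ (List.prefix_refl _)⟩
  obtain ⟨⟨R, V, hR, hV⟩, -⟩ := (PolyTime.id (α := α)).pair (hg.pair hl)
  obtain ⟨⟨P, T, hP, C, p, hT⟩, -⟩ := hh
  -- The body receives context, accumulator and list element as nested pairs; the 2 counts the two
  -- pairing cells.
  have hτ : PolyBdd (fun a => C * (tsize a + B a + tsize (l a) + 2) ^ p) :=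
    (PolyBdd.const C).mul ((((PolyBdd.size.add hB).add hl.2).add (.const 2)).pow p)
  refine ⟨.seq R (foldCmd P), _, ?_, (hV.add (.const 20)).add (hl.2.mul (hτ.add (.const 20)))⟩
  intro a s hs
  obtain ⟨s₁, t₁, h₁, e₁, b₁⟩ := hR a s hs
  obtain ⟨s₂, t₂, h₂, e₂, b₂⟩ := foldCmd_runs hP a (g a) (l a)
    (C * (tsize a + B a + tsize (l a) + 2) ^ p) (fun l₁ b l₂ e => by
      refine (hT _).trans ?_
      have h1 := hbd a l₁ ⟨b :: l₂, e.symm⟩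
      have h2 : tsize b ≤ tsize (l a) := tsize_le_of_mem (by simp [e])
      simp only [tsize_pair]
      exact Nat.mul_le_mul_left _ (Nat.pow_le_pow_left (by omega) _)) s₁ e₁
  refine ⟨s₂, _, .seq h₁ h₂, e₂, ?_⟩
  have := Nat.mul_le_mul_right (C * (tsize a + B a + tsize (l a) + 2) ^ p + 20)
    (length_le_tsize (l a))
  dsimp only
  omega

end basics


section library

variable {α β γ δ σ : Type} [TreeCode α] [TreeCode β] [TreeCode γ] [TreeCode δ] [TreeCode σ]

/-! ### Booleans -/

theorem PolyTime.not {c : α → Bool} (hc : PolyTime c) : PolyTime (fun a => !c a) :=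
  (hc.ite (.const false) (.const true)).of_eq fun a => by cases c a <;> rfl

theorem PolyTime.and {c d : α → Bool} (hc : PolyTime c) (hd : PolyTime d) :
    PolyTime (fun a => c a && d a) :=
  (hc.ite hd (.const false)).of_eq fun a => by cases c a <;> rfl

/-! ### Lists -/

theorem PolyTime.cons {f : α → β} {l : α → List β} (hf : PolyTime f) (hl : PolyTime l) :
    PolyTime (fun a => f a :: l a) :=
  (hf.pair hl).congr fun _ => rfl

theorem PolyTime.tail {l : α → List β} (hl : PolyTime l) : PolyTime (fun a => (l a).tail) := by
  refine PolyTime.comp (g := fun l : List β => l.tail) (.ofExpr (.tl (.var 0)) (fun l s h => ?_)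
    (PolyBdd.size.mono fun l => ?_)) hl
  · cases l <;> simp [WhileExpr.eval, h] <;> rfl
  · cases l
    · simp
    · simp; omega

theorem PolyTime.isEmpty {l : α → List β} (hl : PolyTime l) :
    PolyTime (fun a => (l a).isEmpty) := by
  refine PolyTime.comp (g := fun l : List β => l.isEmpty) ?_ hl
  refine ((PolyTime.test (c := fun l : List β => !l.isEmpty) fun l => ?_).not).of_eq fun l => by simp
  cases l
  · simp; rfl
  · simp only [List.isEmpty_cons, Bool.not_false, Bool.true_eq_false, iff_false]
    intro h; cases h

theorem PolyTime.reverse {l : α → List β} (hl : PolyTime l) :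
    PolyTime (fun a => (l a).reverse) := by
  have h : ∀ l : List β, l.foldl (fun acc b => b :: acc) [] = l.reverse := fun l => by simp
  refine (PolyTime.foldl (g := fun _ => []) (h := fun (_ : α) acc b => b :: acc) hl (.const [])
    (.cons (.comp .snd .snd) (.comp .fst .snd)) hl.size fun a l' h' => ?_).of_eq fun a => h _
  rw [h, tsize_reverse]
  exact tsize_le_of_sublist h'.sublist

/-- Lists grow only at the front, so the reversal of the first list is pushed onto the second. -/
theorem PolyTime.append {l m : α → List β} (hl : PolyTime l) (hm : PolyTime m) :
    PolyTime (fun a => l a ++ m a) := by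
  have h : ∀ l m : List β, l.foldl (fun acc b => b :: acc) m = l.reverse ++ m := fun l m => by simp
  refine (PolyTime.foldl (h := fun (_ : α) acc b => b :: acc) hl.reverse hm
    (.cons (.comp .snd .snd) (.comp .fst .snd)) (hl.size.add hm.size)
    fun a l' h' => ?_).of_eq fun a => by simp
  rw [h]
  have h1 := tsize_append l'.reverse (m a)
  have h2 := tsize_le_of_sublist h'.sublist
  rw [tsize_reverse] at h1 h2
  omega

/-- An element is no larger than its list, so a polynomial in the pair gives a bound in `a` alone,
uniform over the list. -/
theorem PolyBdd.bound_mem {g : α × β → ℕ} {l : α → List β} (hg : PolyBdd g)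
    (hl : PolyBdd fun a => tsize (l a)) :
    ∃ B : α → ℕ, PolyBdd B ∧ ∀ a, ∀ b ∈ l a, g (a, b) ≤ B a := by
  obtain ⟨C, p, hg⟩ := hg
  refine ⟨_, (PolyBdd.const C).mul (((PolyBdd.size.add hl).add (.const 1)).pow p),
    fun a b hb => (hg _).trans ?_⟩
  have := tsize_le_of_mem hb
  rw [tsize_pair]
  exact Nat.mul_le_mul_left _ (Nat.pow_le_pow_left (by omega) _)

theorem PolyTime.map {l : α → List β} {f : α → β → γ} (hl : PolyTime l)
    (hf : PolyTime fun p : α × β => f p.1 p.2) : PolyTime (fun a => (l a).map (f a)) := by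
  have h : ∀ a (l : List β), l.foldl (fun acc b => f a b :: acc) [] = (l.map (f a)).reverse := by
    intro a l
    rw [← List.foldl_map (f := f a) (g := fun acc b => b :: acc)]
    simp
  obtain ⟨B, hB, hfB⟩ := hf.size.bound_mem hl.size
  refine ((PolyTime.foldl (g := fun _ => []) (h := fun a acc b => f a b :: acc) hl (.const [])
    (.cons (hf.comp (.pair .fst (.comp .snd .snd))) (.comp .fst .snd))
    ((hl.size.mul (hB.add (.const 1))).add (.const 1)) fun a l' h' => ?_).reverse).of_eq
    fun a => by rw [h, List.reverse_reverse]
  rw [h, tsize_reverse]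
  refine (tsize_list_le (B := B a) ?_).trans ?_
  · intro c hc
    obtain ⟨b, hb, rfl⟩ := List.mem_map.1 hc
    exact hfB a b (h'.subset hb)
  · rw [List.length_map]
    have h1 := (h'.length_le).trans (length_le_tsize (l a))
    exact Nat.add_le_add_right (Nat.mul_le_mul_right _ h1) 1

theorem PolyTime.filter {l : α → List β} {f : α → β → Bool} (hl : PolyTime l)
    (hf : PolyTime fun p : α × β => f p.1 p.2) : PolyTime (fun a => (l a).filter (f a)) := by
  have h : ∀ a (l acc : List β), l.foldl (fun acc b => if f a b then b :: acc else acc) acc =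
      (l.filter (f a)).reverse ++ acc := by
    intro a l
    induction l with
    | nil => simp
    | cons b l ih =>
      intro acc
      rw [List.foldl_cons, ih, List.filter_cons]
      split_ifs <;> simp
  refine ((PolyTime.foldl (g := fun _ => []) (h := fun a acc b => if f a b then b :: acc else acc)
    hl (.const []) (.ite (hf.comp (.pair .fst (.comp .snd .snd)))
      (.cons (.comp .snd .snd) (.comp .fst .snd)) (.comp .fst .snd)) hl.size
    fun a l' h' => ?_).reverse).of_eq fun a => by rw [h]; simp
  rw [h, List.append_nil, tsize_reverse]
  exact tsize_le_of_sublist (List.filter_sublist.trans h'.sublist)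

theorem PolyTime.any {l : α → List β} {f : α → β → Bool} (hl : PolyTime l)
    (hf : PolyTime fun p : α × β => f p.1 p.2) : PolyTime (fun a => (l a).any (f a)) :=
  ((hl.filter hf).isEmpty.not).of_eq fun a => by
    rw [Bool.eq_iff_iff]; simp

theorem tsize_flatten_le (l : List (List β)) : tsize l.flatten ≤ tsize l := by
  induction l with
  | nil => simp
  | cons a l ih =>
    have := tsize_append a l.flatten
    simp only [List.flatten_cons, tsize_cons]
    omega

theorem PolyTime.flatten {l : α → List (List β)} (hl : PolyTime l) :
    PolyTime (fun a => (l a).flatten) := by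
  have h : ∀ (l : List (List β)) (acc : List β), l.foldl (fun acc b => acc ++ b) acc =
      acc ++ l.flatten := by
    intro l
    induction l with
    | nil => simp
    | cons b l ih => intro acc; simp [ih]
  refine (PolyTime.foldl (g := fun _ => []) (h := fun (_ : α) acc b => acc ++ b)
    hl (.const []) (.append (.comp .fst .snd) (.comp .snd .snd)) hl.size
    fun a l' h' => ?_).of_eq fun a => by rw [h]; simp
  rw [h, List.nil_append]
  exact (tsize_flatten_le _).trans (tsize_le_of_sublist h'.sublist)

theorem PolyTime.flatMap {l : α → List β} {f : α → β → List γ} (hl : PolyTime l)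
    (hf : PolyTime fun p : α × β => f p.1 p.2) : PolyTime (fun a => (l a).flatMap (f a)) :=
  (hl.map hf).flatten.of_eq fun a => by rw [List.flatMap_def]

/-! ### Options -/

theorem PolyTime.some {f : α → β} (hf : PolyTime f) : PolyTime (fun a => some (f a)) :=
  (hf.cons (.const [])).congr fun _ => rfl

theorem PolyTime.toList {o : α → Option β} (ho : PolyTime o) : PolyTime (fun a => (o a).toList) :=
  ho.congr fun _ => rfl

theorem PolyTime.isSome {o : α → Option β} (ho : PolyTime o) : PolyTime (fun a => (o a).isSome) :=
  ho.toList.isEmpty.not.of_eq fun a => by cases o a <;> rfl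

/-- An option is a list of length at most one, so this is a fold whose body ignores the accumulator.
-/
theorem PolyTime.option_elim {o : α → Option β} {g : α → γ} {f : α → β → γ} (ho : PolyTime o)
    (hg : PolyTime g) (hf : PolyTime fun p : α × β => f p.1 p.2) :
    PolyTime (fun a => (o a).elim (g a) (f a)) := by
  obtain ⟨B, hB, hfB⟩ := hf.size.bound_mem ho.toList.size
  refine (PolyTime.foldl (h := fun a _ b => f a b) ho.toList hg
    (hf.comp (.pair .fst (.comp .snd .snd))) (hg.size.add hB) fun a l' h' => ?_).of_eq
    fun a => by cases o a <;> rfl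
  rcases l'.eq_nil_or_concat with rfl | ⟨l, b, rfl⟩
  · simp
  · have := hfB a b (h'.subset (by simp))
    simp only [List.concat_eq_append, List.foldl_append, List.foldl_cons,
      List.foldl_nil] at this ⊢
    omega

theorem PolyTime.option_map {o : α → Option β} {f : α → β → γ} (ho : PolyTime o)
    (hf : PolyTime fun p : α × β => f p.1 p.2) : PolyTime (fun a => (o a).map (f a)) :=
  (ho.option_elim (.const none) (f := fun a b => Option.some (f a b)) hf.some).of_eq
    fun a => by cases o a <;> rfl

theorem PolyTime.head? {l : α → List β} (hl : PolyTime l) : PolyTime (fun a => (l a).head?) := by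
  have h : ∀ (l : List β) (acc : Option β),
      l.foldl (fun acc b => if acc.isSome then acc else Option.some b) acc = acc.or l.head? := by
    intro l
    induction l with
    | nil => simp
    | cons b l ih => intro acc; rw [List.foldl_cons, ih]; cases acc <;> simp
  refine (PolyTime.foldl (g := fun _ => none)
    (h := fun (_ : α) acc b => if acc.isSome then acc else Option.some b)
    hl (.const none) (.ite (.isSome (.comp .fst .snd)) (.comp .fst .snd)
      (.some (.comp .snd .snd))) hl.size
    fun a l' h' => ?_).of_eq fun a => by rw [h]; simp
  rw [h, Option.none_or]
  refine le_trans ?_ (tsize_le_of_sublist h'.sublist)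
  cases l' with
  | nil => exact le_rfl
  | cons b l => change tsize [b] ≤ _; have := tsize_pos l; simp; omega

theorem PolyTime.find? {l : α → List β} {f : α → β → Bool} (hl : PolyTime l)
    (hf : PolyTime fun p : α × β => f p.1 p.2) : PolyTime (fun a => (l a).find? (f a)) :=
  (hl.filter hf).head?.of_eq fun a => by simp [List.head?_filter]

/-! ### Natural numbers -/

theorem PolyTime.succ {n : α → ℕ} (hn : PolyTime n) : PolyTime (fun a => n a + 1) :=
  ((PolyTime.const ()).pair hn).congr fun _ => rfl

theorem PolyTime.replicate {n : α → ℕ} (hn : PolyTime n) :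
    PolyTime (fun a => List.replicate (n a) ()) := hn.congr fun _ => rfl

theorem PolyTime.length {l : α → List β} (hl : PolyTime l) : PolyTime (fun a => (l a).length) :=
  (hl.map (f := fun _ _ => ()) (.const ())).congr fun a => by
    rw [List.map_const']; rfl

theorem PolyTime.nat_add {n m : α → ℕ} (hn : PolyTime n) (hm : PolyTime m) :
    PolyTime (fun a => n a + m a) :=
  (hn.replicate.append hm.replicate).congr fun a => by
    rw [List.replicate_append_replicate]; rfl

theorem PolyTime.pred {n : α → ℕ} (hn : PolyTime n) : PolyTime (fun a => n a - 1) :=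
  hn.replicate.tail.congr fun a => by rw [List.tail_replicate]; rfl

theorem PolyTime.isZero {n : α → ℕ} (hn : PolyTime n) : PolyTime (fun a => decide (n a = 0)) :=
  hn.replicate.isEmpty.of_eq fun a => by cases h : n a <;> simp [List.replicate_succ]

/-- A number is a list of units, so iteration is a fold that ignores the list elements. -/
theorem PolyTime.iterate {n : α → ℕ} {g : α → σ} {h : α → σ → σ} {B : α → ℕ}
    (hn : PolyTime n) (hg : PolyTime g) (hh : PolyTime (fun q : α × σ => h q.1 q.2))
    (hB : PolyBdd B) (hbd : ∀ a i, i ≤ n a → tsize ((h a)^[i] (g a)) ≤ B a) :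
    PolyTime (fun a => (h a)^[n a] (g a)) := by
  have key : ∀ a (l : List Unit) (z : σ), l.foldl (fun z _ => h a z) z = (h a)^[l.length] z := by
    intro a l
    induction l with
    | nil => intro z; rfl
    | cons b l ih => intro z; rw [List.foldl_cons, ih]; rfl
  refine (PolyTime.foldl (h := fun a z _ => h a z) hn.replicate hg
    (hh.comp (.pair .fst (.comp .fst .snd))) hB fun a l' h' => ?_).of_eq fun a => by
      rw [key, List.length_replicate]
  rw [key]
  exact hbd a _ (by simpa using h'.length_le)

theorem PolyTime.nat_sub {n m : α → ℕ} (hn : PolyTime n) (hm : PolyTime m) :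
    PolyTime (fun a => n a - m a) := by
  have h : ∀ i n : ℕ, (fun x => x - 1)^[i] n = n - i := by
    intro i
    induction i with
    | zero => simp
    | succ i ih => intro n; rw [Function.iterate_succ_apply, ih]; omega
  refine (PolyTime.iterate (h := fun (_ : α) x => x - 1) hm hn (.pred .snd) hn.size
    fun a i _ => ?_).of_eq fun a => h _ _
  rw [h, tsize_nat, tsize_nat]; omega

theorem PolyTime.nat_le {n m : α → ℕ} (hn : PolyTime n) (hm : PolyTime m) :
    PolyTime (fun a => decide (n a ≤ m a)) :=
  (hn.nat_sub hm).isZero.of_eq fun a => by simp [Nat.sub_eq_zero_iff_le]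

theorem PolyTime.nat_eq {n m : α → ℕ} (hn : PolyTime n) (hm : PolyTime m) :
    PolyTime (fun a => decide (n a = m a)) :=
  ((hn.nat_le hm).and (hm.nat_le hn)).of_eq fun a => by
    rw [Bool.eq_iff_iff]; simp; omega

theorem PolyTime.range {n : α → ℕ} (hn : PolyTime n) : PolyTime (fun a => List.range (n a)) := by
  have h : ∀ i, (fun l : List ℕ => l ++ [l.length])^[i] [] = List.range i := by
    intro i
    induction i with
    | zero => rfl
    | succ i ih => rw [Function.iterate_succ_apply', ih, List.range_succ]; simp
  refine (PolyTime.iterate (g := fun _ => []) (h := fun (_ : α) (l : List ℕ) => l ++ [l.length]) hn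
    (.const []) (.append .snd (.cons (.length .snd) (.const [])))
    ((hn.size.mul (hn.size.add (.const 1))).add (.const 1)) fun a i hi => ?_).of_eq fun a => h _
  rw [h]
  refine (tsize_list_le (B := tsize (n a)) ?_).trans ?_
  · intro j hj
    have := List.mem_range.1 hj
    rw [tsize_nat, tsize_nat]; omega
  · rw [List.length_range]
    exact Nat.add_le_add_right (Nat.mul_le_mul_right _ (by rw [tsize_nat]; omega)) 1

theorem PolyTime.drop {l : α → List β} {n : α → ℕ} (hl : PolyTime l) (hn : PolyTime n) :
    PolyTime (fun a => (l a).drop (n a)) := by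
  have h : ∀ (i : ℕ) (l : List β), List.tail^[i] l = l.drop i := by
    intro i
    induction i with
    | zero => intro l; rfl
    | succ i ih => intro l; rw [Function.iterate_succ_apply, ih]; simp [List.drop_tail]
  refine (PolyTime.iterate (h := fun (_ : α) l => List.tail l) hn hl (.tail .snd) hl.size
    fun a i _ => ?_).of_eq fun a => h _ _
  rw [h]
  exact tsize_le_of_sublist (List.drop_sublist _ _)

theorem PolyTime.getD {l : α → List β} {n : α → ℕ} {d : α → β} (hl : PolyTime l)
    (hn : PolyTime n) (hd : PolyTime d) : PolyTime (fun a => (l a).getD (n a) (d a)) :=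
  ((hl.drop hn).head?.option_elim hd (f := fun _ b => b) .snd).of_eq fun a => by
    rw [List.head?_drop, List.getD_eq_getElem?_getD]
    cases (l a)[n a]? <;> rfl

/-! ### Finite case distinctions -/

/-- Every function that is polynomial time computable for each of the values of its first argument
is polynomial time computable. -/
def FinCase (α : Type) [TreeCode α] : Prop :=
  ∀ (δ β : Type) [TreeCode δ] [TreeCode β] (f : α → δ → β), (∀ a, PolyTime (f a)) →
    PolyTime (fun p : α × δ => f p.1 p.2)

theorem FinCase.comp (h : FinCase α) {f : α → δ → β} {x : γ → α} {y : γ → δ}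
    (hf : ∀ a, PolyTime (f a)) (hx : PolyTime x) (hy : PolyTime y) :
    PolyTime (fun c => f (x c) (y c)) :=
  (h _ _ f hf).comp (hx.pair hy)

/-- Peeling off zero `m` times gives a fixed program with finitely many branches; `min` turns the
last one into a catch-all. -/
theorem PolyTime.cases_min (m : ℕ) : ∀ f : ℕ → δ → β, (∀ i, PolyTime (f i)) →
    PolyTime (fun p : ℕ × δ => f (min p.1 m) p.2) := by
  induction m with
  | zero => intro f hf; exact ((hf 0).comp .snd).of_eq fun p => by simp
  | succ m ih =>
    intro f hf
    refine (PolyTime.ite (PolyTime.isZero .fst) ((hf 0).comp .snd)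
      ((ih (fun i => f (i + 1)) fun i => hf _).comp
        (.pair (.pred .fst) .snd))).of_eq fun p => ?_
    by_cases h : p.1 = 0
    · simp [h]
    · have : min p.1 (m + 1) = min (p.1 - 1) m + 1 := by omega
      simp [h, this]

theorem finCase_fin (m : ℕ) : FinCase (Fin m) := by
  intro δ β _ _ f hf
  cases m with
  | zero =>
    -- There are no arguments, so every program and every bound will do.
    refine ⟨⟨.skip, fun _ => 0, fun p => p.1.elim0, .const 0⟩, 1, 0, fun p => p.1.elim0⟩
  | succ m =>
    -- The default `0` for indices out of range is never used, as the index is at most `m`.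
    refine ((PolyTime.cases_min m (fun i => f (if h : i < m + 1 then ⟨i, h⟩ else 0))
      fun i => hf _).comp (f := fun p : Fin (m + 1) × δ => (p.1.val, p.2))
      (.recode fun _ => rfl)).of_eq fun p => ?_
    have h2 : p.1.val ≤ m := by omega
    simp [h2]

theorem FinCase.option (h : FinCase α) : FinCase (Option α) := by
  intro δ β _ _ f hf
  refine (PolyTime.option_elim (o := fun p : Option α × δ => p.1) (f := fun p a => f (some a) p.2)
    .fst ((hf none).comp .snd) (h.comp (f := fun a d => f (some a) d) (fun a => hf _) .snd
      (.comp .snd .fst))).of_eq fun p => by rcases p with ⟨_ | _, _⟩ <;> rfl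

theorem FinCase.prod (h : FinCase α) (h' : FinCase β) : FinCase (α × β) := by
  intro δ γ _ _ f hf
  exact h.comp (f := fun a (q : β × δ) => f (a, q.1) q.2)
    (fun a => h' _ _ (fun b d => f (a, b) d) fun b => hf _) (.comp .fst .fst)
    (.pair (.comp .snd .fst) .snd)

/-- The values are constants of the program, so the function may be arbitrary, even one defined by
choice. The operations on shapes and cells enter the algorithm this way. -/
theorem FinCase.polyTime (h : FinCase α) (f : α → β) : PolyTime f :=
  (h _ _ (fun a (_ : Unit) => f a) fun _ => .const _).comp (PolyTime.id.pair (.const ()))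

/-! ### Vectors -/

instance {m : ℕ} : TreeCode (Fin m → β) := ⟨fun f => code (List.ofFn f)⟩

theorem PolyTime.ofFn {m : ℕ} {f : Fin m → α → β} (hf : ∀ i, PolyTime (f i)) :
    PolyTime (fun a => List.ofFn fun i => f i a) := by
  induction m with
  | zero => exact (PolyTime.const []).of_eq fun a => by simp
  | succ m ih =>
    exact ((hf 0).cons (ih fun i => hf i.succ)).of_eq fun a => by rw [List.ofFn_succ]

theorem PolyTime.pi {m : ℕ} {f : α → Fin m → β} (hf : ∀ i, PolyTime fun a => f a i) :
    PolyTime f := (PolyTime.ofFn hf).congr fun _ => rfl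

theorem code_vec_succ {m : ℕ} (v : Fin (m + 1) → β) :
    code v = code (v 0, fun i : Fin m => v i.succ) := by
  change code (List.ofFn v) = _
  rw [List.ofFn_succ]; rfl

theorem PolyTime.apply {m : ℕ} (i : Fin m) : PolyTime (fun v : Fin m → β => v i) := by
  induction m with
  | zero => exact i.elim0
  | succ m ih =>
    have h : PolyTime (fun v : Fin (m + 1) → β => (v 0, fun i : Fin m => v i.succ)) :=
      .recode fun v => (code_vec_succ v).symm
    refine Fin.cases ?_ (fun j => ?_) i
    · exact PolyTime.fst.comp h
    · exact (ih j).comp (PolyTime.snd.comp h)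

theorem PolyTime.forall_fin {m : ℕ} {c : Fin m → α → Bool} (hc : ∀ i, PolyTime (c i)) :
    PolyTime (fun a => decide (∀ i, c i a = true)) := by
  induction m with
  | zero => exact (PolyTime.const true).of_eq fun a => by simp
  | succ m ih =>
    exact ((hc 0).and (ih fun i => hc i.succ)).of_eq fun a => by
      rw [Bool.eq_iff_iff]; simp [Fin.forall_fin_succ]

theorem PolyTime.vec_eq {m : ℕ} {v w : α → Fin m → ℕ} (hv : PolyTime v) (hw : PolyTime w) :
    PolyTime (fun a => decide (v a = w a)) :=
  (PolyTime.forall_fin (c := fun i a => decide (v a i = w a i)) fun i =>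
    ((PolyTime.apply i).comp hv).nat_eq ((PolyTime.apply i).comp hw)).of_eq fun a => by
      rw [Bool.eq_iff_iff]; simp [funext_iff]

theorem PolyTime.vec_add {m : ℕ} {v w : α → Fin m → ℕ} (hv : PolyTime v) (hw : PolyTime w) :
    PolyTime (fun a => v a + w a) :=
  .pi fun i => ((PolyTime.apply i).comp hv).nat_add ((PolyTime.apply i).comp hw)

/-- All vectors of length `m` with entries at most `n`. -/
def vecsUpTo : (m n : ℕ) → List (Fin m → ℕ)
  | 0, _ => [fun i => i.elim0]
  | m + 1, n => (List.range (n + 1)).flatMap fun i => (vecsUpTo m n).map (Fin.cons i)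

theorem mem_vecsUpTo {m n : ℕ} {v : Fin m → ℕ} : v ∈ vecsUpTo m n ↔ ∀ i, v i ≤ n := by
  induction m with
  | zero => simp [vecsUpTo, funext_iff]
  | succ m ih =>
    simp only [vecsUpTo, List.mem_flatMap, List.mem_range, List.mem_map, ih]
    constructor
    · rintro ⟨i, hi, w, hw, rfl⟩ j
      refine Fin.cases ?_ (fun j => ?_) j
      · simpa using Nat.lt_succ_iff.1 hi
      · simpa using hw j
    · intro h
      exact ⟨v 0, Nat.lt_succ_iff.2 (h 0), Fin.tail v, fun i => h i.succ, Fin.cons_self_tail v⟩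

/-- The length `m` is fixed, so the `(n + 1) ^ m` vectors form a list of polynomial size. -/
theorem PolyTime.vecsUpTo (m : ℕ) {n : α → ℕ} (hn : PolyTime n) :
    PolyTime (fun a => vecsUpTo m (n a)) := by
  induction m with
  | zero => exact .const _
  | succ m ih =>
    have h : PolyTime (fun q : (α × ℕ) × (Fin m → ℕ) => (q.1.2, q.2)) :=
      .pair (.comp .snd .fst) .snd
    have h' : PolyTime (fun q : (α × ℕ) × (Fin m → ℕ) =>
        (Fin.cons q.1.2 q.2 : Fin (m + 1) → ℕ)) := h.congr fun q => by
      rw [code_vec_succ]; rfl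
    exact PolyTime.flatMap (PolyTime.range hn.succ) (PolyTime.map
      (f := fun (p : α × ℕ) (v : Fin m → ℕ) => (Fin.cons p.2 v : Fin (m + 1) → ℕ))
      (ih.comp .fst) h')

end library


/-! ### Ordered rooted trees as shapes of induced subtrees -/

/-- The number of vertices of the ordered rooted tree that is represented by a tree of cons cells:
`nil` is a single vertex, and `cons y x` is `x` with `y` as an additional first subtree. -/
def shapeSize : ConsTree → ℕ
  | .nil => 1
  | .cons y x => shapeSize x + shapeSize y

theorem shapeSize_pos (x : ConsTree) : 0 < shapeSize x := by
  induction x with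
  | nil => simp [shapeSize]
  | cons y x _ ih => simp only [shapeSize]; omega

/-- A composite shape splits into two strictly smaller ones, because each of them has a vertex.
Finiteness makes the states of the dynamic program a constant amount of data. -/
theorem finite_shapes (c : ℕ) : {x : ConsTree | shapeSize x ≤ c}.Finite := by
  induction c with
  | zero =>
    refine Set.Finite.subset Set.finite_empty fun x hx => ?_
    have := shapeSize_pos x
    simp only [Set.mem_ofPred_eq] at hx
    omega
  | succ c ih =>
    refine ((Set.finite_singleton ConsTree.nil).union
      (Set.Finite.image2 ConsTree.cons ih ih)).subset fun x hx => ?_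
    cases x with
    | nil => exact Or.inl rfl
    | cons y x =>
      have h1 := shapeSize_pos x
      have h2 := shapeSize_pos y
      simp only [Set.mem_ofPred_eq, shapeSize] at hx
      exact Or.inr ⟨y, by simp only [Set.mem_ofPred_eq]; omega, x,
        by simp only [Set.mem_ofPred_eq]; omega, rfl⟩

section packings

set_option linter.unusedSectionVars false

variable {V V' : Type} [DecidableEq V] [DecidableEq V'] {G : SimpleGraph V} {G' : SimpleGraph V'}

/-- Two sets of vertices are disjoint, and there are no edges between them. -/
def Sep (G : SimpleGraph V) (A B : Finset V) : Prop := ∀ a ∈ A, ∀ b ∈ B, a ≠ b ∧ ¬ G.Adj a b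

theorem Sep.symm {A B : Finset V} (h : Sep G A B) : Sep G B A :=
  fun a ha b hb => ⟨(h b hb a ha).1.symm, fun e => (h b hb a ha).2 e.symm⟩

theorem Sep.disjoint {A B : Finset V} (h : Sep G A B) : Disjoint A B :=
  Finset.disjoint_left.2 fun a ha hb => (h a ha a hb).1 rfl

theorem Sep.mono {A B A' B' : Finset V} (h : Sep G A B) (hA : A' ⊆ A) (hB : B' ⊆ B) :
    Sep G A' B' := fun a ha b hb => h a (hA ha) b (hB hb)

theorem Sep.union_left {A B C : Finset V} (hA : Sep G A C) (hB : Sep G B C) :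
    Sep G (A ∪ B) C := fun a ha => (Finset.mem_union.1 ha).elim (hA a) (hB a)

theorem Sep.union_right {A B C : Finset V} (hA : Sep G C A) (hB : Sep G C B) :
    Sep G C (A ∪ B) := (Sep.union_left hA.symm hB.symm).symm

theorem sep_empty (A : Finset V) : Sep G A ∅ := fun _ _ _ hb => absurd hb (Finset.notMem_empty _)

/-- `IsTr G x r A` says that `G` induces on `A` a tree, which becomes the ordered rooted tree `x`
if its root is chosen to be `r` and the subtrees are ordered suitably. -/
inductive IsTr (G : SimpleGraph V) : ConsTree → V → Finset V → Prop
  | single (r : V) : IsTr G .nil r {r}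
  | graft {x y : ConsTree} {r r' : V} {A B : Finset V} (hA : IsTr G x r A) (hB : IsTr G y r' B)
      (hd : Disjoint A B) (he : G.Adj r r')
      (ho : ∀ a ∈ A, ∀ b ∈ B, G.Adj a b → a = r ∧ b = r') : IsTr G (.cons y x) r (A ∪ B)

theorem IsTr.root_mem {x : ConsTree} {r : V} {A : Finset V} (h : IsTr G x r A) : r ∈ A := by
  induction h with
  | single r => simp
  | graft _ _ _ _ _ ih _ => exact Finset.mem_union_left _ ih

theorem IsTr.card {x : ConsTree} {r : V} {A : Finset V} (h : IsTr G x r A) :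
    A.card = shapeSize x := by
  induction h with
  | single r => rfl
  | graft _ _ hd _ _ ih₁ ih₂ => rw [Finset.card_union_of_disjoint hd, ih₁, ih₂]; rfl

/-- An induced tree is connected: the edge used in each grafting keeps the root of the new subtree
on the side of the old root. -/
theorem IsTr.subset_of_root {x : ConsTree} {r : V} {A P Q : Finset V} (h : IsTr G x r A)
    (hA : A ⊆ P ∪ Q) (hs : Sep G P Q) (hr : r ∈ P) : A ⊆ P := by
  induction h with
  | single r => simpa using hr
  | @graft x y r r' A B _ hB _ he _ ih₁ ih₂ =>
    refine Finset.union_subset (ih₁ (Finset.subset_union_left.trans hA) hr)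
      (ih₂ (Finset.subset_union_right.trans hA) ?_)
    rcases Finset.mem_union.1 (hA (Finset.mem_union_right _ hB.root_mem)) with h | h
    · exact h
    · exact absurd he (hs r hr r' h).2

/-- If the root were in `Q`, then all of `A`, including `v`, would lie in `Q`. -/
theorem IsTr.subset_of_mem {x : ConsTree} {r v : V} {A P Q : Finset V} (h : IsTr G x r A)
    (hA : A ⊆ P ∪ Q) (hs : Sep G P Q) (hv : v ∈ A) (hP : v ∈ P) : A ⊆ P := by
  rcases Finset.mem_union.1 (hA h.root_mem) with hr | hr
  · exact h.subset_of_root hA hs hr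
  · rw [Finset.union_comm] at hA
    exact absurd rfl (hs v hP v (h.subset_of_root hA hs.symm hr hv)).1

/-! ### Isomorphisms between induced subgraphs -/

/-- `f` is an isomorphism from the subgraph of `G` induced by `A` to the subgraph of `G'` induced
by the image of `A`. -/
def LocalIso (G : SimpleGraph V) (G' : SimpleGraph V') (A : Finset V) (f : V → V') : Prop :=
  Set.InjOn f A ∧ ∀ a ∈ A, ∀ b ∈ A, G.Adj a b ↔ G'.Adj (f a) (f b)

theorem LocalIso.mono {A B : Finset V} {f : V → V'} (h : LocalIso G G' A f) (hB : B ⊆ A) :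
    LocalIso G G' B f :=
  ⟨h.1.mono (Finset.coe_subset.2 hB), fun a ha b hb => h.2 a (hB ha) b (hB hb)⟩

theorem LocalIso.of_embedding (f : G ↪g G') (A : Finset V) : LocalIso G G' A f :=
  ⟨f.injective.injOn, fun _ _ _ _ => f.map_rel_iff.symm⟩

theorem LocalIso.disjoint {A B : Finset V} {f : V → V'} (h : LocalIso G G' (A ∪ B) f)
    (hd : Disjoint A B) : Disjoint (A.image f) (B.image f) := by
  rw [Finset.disjoint_left] at hd ⊢
  intro x hA hB
  obtain ⟨a, ha, rfl⟩ := Finset.mem_image.1 hA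
  obtain ⟨b, hb, e⟩ := Finset.mem_image.1 hB
  have := h.1 (by simp [hb]) (by simp [ha]) e
  exact hd ha (this ▸ hb)

theorem LocalIso.sep {A B : Finset V} {f : V → V'} (h : LocalIso G G' (A ∪ B) f)
    (hs : Sep G A B) : Sep G' (A.image f) (B.image f) := by
  intro x hx y hy
  refine ⟨fun e => Finset.disjoint_left.1 (h.disjoint hs.disjoint) hx (e ▸ hy), ?_⟩
  obtain ⟨a, ha, rfl⟩ := Finset.mem_image.1 hx
  obtain ⟨b, hb, rfl⟩ := Finset.mem_image.1 hy
  rw [← h.2 a (by simp [ha]) b (by simp [hb])]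
  exact (hs a ha b hb).2

theorem IsTr.map {x : ConsTree} {r : V} {A : Finset V} {f : V → V'} (h : IsTr G x r A)
    (hf : LocalIso G G' A f) : IsTr G' x (f r) (A.image f) := by
  induction h with
  | single r => rw [Finset.image_singleton]; exact .single _
  | @graft x y r r' A B hA hB hd he ho ih₁ ih₂ =>
    rw [Finset.image_union]
    refine .graft (ih₁ (hf.mono Finset.subset_union_left)) (ih₂ (hf.mono Finset.subset_union_right))
      (hf.disjoint hd) ?_ ?_
    · rwa [← hf.2 r (by simp [hA.root_mem]) r' (by simp [hB.root_mem])]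
    · intro u hu v hv
      obtain ⟨a, ha, rfl⟩ := Finset.mem_image.1 hu
      obtain ⟨b, hb, rfl⟩ := Finset.mem_image.1 hv
      rw [← hf.2 a (by simp [ha]) b (by simp [hb])]
      intro e
      obtain ⟨rfl, rfl⟩ := ho a ha b hb e
      exact ⟨rfl, rfl⟩

/-- The hypothesis `hc` matches the edges across. It serves both for a grafting, with one such edge,
and for separate components, with none. -/
theorem LocalIso.glue {A B : Finset V} {f g : V → V'} (hf : LocalIso G G' A f)
    (hg : LocalIso G G' B g) (hd : Disjoint A B) (hd' : Disjoint (A.image f) (B.image g))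
    (hc : ∀ a ∈ A, ∀ b ∈ B, G.Adj a b ↔ G'.Adj (f a) (g b)) :
    LocalIso G G' (A ∪ B) (fun v => if v ∈ A then f v else g v) ∧
      (A ∪ B).image (fun v => if v ∈ A then f v else g v) = A.image f ∪ B.image g := by
  have hB : ∀ b ∈ B, b ∉ A := fun b hb ha => Finset.disjoint_left.1 hd ha hb
  have hne : ∀ a ∈ A, ∀ b ∈ B, f a ≠ g b := fun a ha b hb e =>
    Finset.disjoint_left.1 hd' (Finset.mem_image_of_mem f ha) (e ▸ Finset.mem_image_of_mem g hb)
  refine ⟨⟨?_, ?_⟩, ?_⟩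
  · intro a ha b hb e
    simp only [Finset.coe_union, Set.mem_union, Finset.mem_coe] at ha hb
    dsimp only at e
    rcases ha with ha | ha <;> rcases hb with hb | hb
    · rw [if_pos ha, if_pos hb] at e; exact hf.1 ha hb e
    · rw [if_pos ha, if_neg (hB b hb)] at e; exact absurd e (hne a ha b hb)
    · rw [if_neg (hB a ha), if_pos hb] at e; exact absurd e.symm (hne b hb a ha)
    · rw [if_neg (hB a ha), if_neg (hB b hb)] at e; exact hg.1 ha hb e
  · intro a ha b hb
    dsimp only
    rcases Finset.mem_union.1 ha with ha | ha <;> rcases Finset.mem_union.1 hb with hb | hb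
    · rw [if_pos ha, if_pos hb]; exact hf.2 a ha b hb
    · rw [if_pos ha, if_neg (hB b hb)]; exact hc a ha b hb
    · rw [if_neg (hB a ha), if_pos hb, G.adj_comm, G'.adj_comm]; exact hc b hb a ha
    · rw [if_neg (hB a ha), if_neg (hB b hb)]; exact hg.2 a ha b hb
  · rw [Finset.image_union]
    congr 1
    · exact Finset.image_congr fun a ha => if_pos ha
    · exact Finset.image_congr fun b hb => if_neg (hB b hb)

/-- The isomorphisms of the two parts respect the roots, and the only edge between the parts joins
the roots; hence they glue. -/
theorem IsTr.exists_localIso {x : ConsTree} {r : V} {A : Finset V} (h : IsTr G x r A) :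
    ∀ {r' : V'} {A' : Finset V'}, IsTr G' x r' A' →
      ∃ f, LocalIso G G' A f ∧ A.image f = A' ∧ f r = r' := by
  induction h with
  | single r =>
    intro r' A' h'
    cases h'
    exact ⟨fun _ => r', ⟨by simp, by simp⟩, by simp, rfl⟩
  | @graft x y r s A B hA hB hd he ho ih₁ ih₂ =>
    intro r' C h'
    cases h' with
    | @graft _ _ _ s' A' B' hA' hB' hd' he' ho' =>
      obtain ⟨f, hf, rfl, rfl⟩ := ih₁ hA'
      obtain ⟨g, hg, rfl, rfl⟩ := ih₂ hB'
      obtain ⟨h1, h2⟩ := hf.glue hg hd hd' (fun a ha b hb => by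
        constructor
        · intro e
          obtain ⟨rfl, rfl⟩ := ho a ha b hb e
          exact he'
        · intro e
          obtain ⟨e1, e2⟩ := ho' _ (Finset.mem_image_of_mem f ha) _ (Finset.mem_image_of_mem g hb) e
          rw [hf.1 ha hA.root_mem e1, hg.1 hb hB.root_mem e2]
          exact he)
      exact ⟨_, h1, h2, if_pos hA.root_mem⟩

/-- Two shapes are equivalent if they are shapes of isomorphic trees. -/
def ShapeEquiv (x y : ConsTree) : Prop :=
  ∀ (V : Type) [DecidableEq V] (G : SimpleGraph V) (A : Finset V),
    (∃ r, IsTr G x r A) ↔ ∃ r, IsTr G y r A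

theorem ShapeEquiv.equivalence : Equivalence ShapeEquiv :=
  ⟨fun _ _ _ _ _ => Iff.rfl, fun h V _ G A => (h V G A).symm,
    fun h h' V _ G A => (h V G A).trans (h' V G A)⟩

/-- Every realization of `x` is isomorphic to `A`, and the isomorphism transports the description of
`A` by `y`; likewise with `x` and `y` exchanged. -/
theorem IsTr.shapeEquiv {x y : ConsTree} {r s : V} {A : Finset V} (hx : IsTr G x r A)
    (hy : IsTr G y s A) : ShapeEquiv x y := by
  intro W _ H B
  constructor
  · rintro ⟨t, ht⟩
    obtain ⟨f, hf, rfl, -⟩ := hx.exists_localIso ht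
    exact ⟨_, hy.map hf⟩
  · rintro ⟨t, ht⟩
    obtain ⟨f, hf, rfl, -⟩ := hy.exists_localIso ht
    exact ⟨_, hx.map hf⟩

/-- Every shape is realized by some finite graph. -/
theorem exists_isTr (x : ConsTree) : ∃ (V : Type) (_ : DecidableEq V) (_ : Fintype V)
    (G : SimpleGraph V) (r : V), IsTr G x r Finset.univ := by
  induction x with
  | nil => exact ⟨Unit, inferInstance, inferInstance, ⊥, (), by
      convert IsTr.single ()
      rfl⟩
  | cons y x ihy ihx =>
    obtain ⟨V, _, _, G, r, hx⟩ := ihx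
    obtain ⟨W, _, _, H, s, hy⟩ := ihy
    -- The disjoint union of the two realizations with an edge between their roots. As `fromRel`
    -- symmetrizes, one direction of that edge suffices.
    let K : SimpleGraph (V ⊕ W) := SimpleGraph.fromRel fun a b => match a, b with
      | .inl a, .inl b => G.Adj a b
      | .inr a, .inr b => H.Adj a b
      | .inl a, .inr b => a = r ∧ b = s
      | .inr _, .inl _ => False
    have h1 : LocalIso G K Finset.univ Sum.inl := by
      refine ⟨Sum.inl_injective.injOn, fun a _ b _ => ?_⟩
      simp only [K, SimpleGraph.fromRel_adj, ne_eq, Sum.inl.injEq, G.adj_comm b a,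
        or_self]
      exact ⟨fun h => ⟨h.ne, h⟩, fun h => h.2⟩
    have h2 : LocalIso H K Finset.univ Sum.inr := by
      refine ⟨Sum.inr_injective.injOn, fun a _ b _ => ?_⟩
      simp only [K, SimpleGraph.fromRel_adj, ne_eq, Sum.inr.injEq, H.adj_comm b a,
        or_self]
      exact ⟨fun h => ⟨h.ne, h⟩, fun h => h.2⟩
    refine ⟨V ⊕ W, inferInstance, inferInstance, K, .inl r, ?_⟩
    have := IsTr.graft (hx.map h1) (hy.map h2) ?_ ?_ ?_
    · convert this
      ext v; cases v <;> simp
    · rw [Finset.disjoint_left]; simp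
    · simp [K]
    · simp [K]

/-! ### Induced packings of trees -/

/-- `Pack G c L W` says that `G` induces on `W` a disjoint union of trees of order at most `c`,
whose shapes are listed in `L`. -/
inductive Pack (G : SimpleGraph V) (c : ℕ) : List ConsTree → Finset V → Prop
  | nil : Pack G c [] ∅
  | cons {x : ConsTree} {r : V} {A W : Finset V} {L : List ConsTree} (hc : shapeSize x ≤ c)
      (hA : IsTr G x r A) (hs : Sep G A W) (hW : Pack G c L W) : Pack G c (x :: L) (A ∪ W)

variable {c : ℕ}

theorem Pack.singleton {x : ConsTree} {r : V} {A : Finset V} (hc : shapeSize x ≤ c)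
    (hA : IsTr G x r A) : Pack G c [x] A := by
  simpa using Pack.cons hc hA (sep_empty A) .nil

theorem Pack.size_le {L : List ConsTree} {W : Finset V} (h : Pack G c L W) :
    ∀ x ∈ L, shapeSize x ≤ c := by
  induction h with
  | nil => simp
  | cons hc _ _ _ ih => simpa [hc] using ih

theorem Pack.card {L : List ConsTree} {W : Finset V} (h : Pack G c L W) :
    W.card = (L.map shapeSize).sum := by
  induction h with
  | nil => rfl
  | cons hc hA hs _ ih =>
    rw [Finset.card_union_of_disjoint hs.disjoint, hA.card, ih, List.map_cons, List.sum_cons]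

theorem Pack.length_le {L : List ConsTree} {W : Finset V} (h : Pack G c L W) :
    L.length ≤ W.card := by
  induction h with
  | nil => simp
  | @cons x r A W L hc hA hs _ ih =>
    have := shapeSize_pos x
    rw [Finset.card_union_of_disjoint hs.disjoint, hA.card, List.length_cons]
    omega

theorem Pack.map {L : List ConsTree} {W : Finset V} {f : V → V'} (h : Pack G c L W)
    (hf : LocalIso G G' W f) : Pack G' c L (W.image f) := by
  induction h with
  | nil => exact .nil
  | cons hc hA hs _ ih =>
    rw [Finset.image_union]
    exact .cons hc (hA.map (hf.mono Finset.subset_union_left)) (hf.sep hs)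
      (ih (hf.mono Finset.subset_union_right))

theorem Pack.append {L L' : List ConsTree} {W W' : Finset V} (h : Pack G c L W)
    (h' : Pack G c L' W') (hs : Sep G W W') : Pack G c (L ++ L') (W ∪ W') := by
  induction h with
  | nil => simpa using h'
  | cons hc hA hs' _ ih =>
    rw [Finset.union_assoc]
    exact .cons hc hA (hs'.union_right (hs.mono Finset.subset_union_left subset_rfl))
      (ih (hs.mono Finset.subset_union_right subset_rfl))

theorem Pack.perm {L L' : List ConsTree} {W : Finset V} (h : Pack G c L W) (hp : L.Perm L') :
    Pack G c L' W := by
  induction hp generalizing W with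
  | nil => exact h
  | cons x _ ih =>
    cases h with
    | cons hc hA hs hW => exact .cons hc hA hs (ih hW)
  | swap x y l =>
    cases h with
    | @cons _ _ A _ _ hc hA hs hW =>
      cases hW with
      | @cons _ _ A' W _ hc' hA' hs' hW' =>
        rw [Finset.union_left_comm]
        exact .cons hc' hA' ((hs.mono subset_rfl Finset.subset_union_left).symm.union_right hs')
          (.cons hc hA (hs.mono subset_rfl Finset.subset_union_right) hW')
  | trans _ _ ih₁ ih₂ => exact ih₂ (ih₁ h)

theorem Pack.exists_localIso [Nonempty V'] {L : List ConsTree} {W : Finset V} (h : Pack G c L W) :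
    ∀ {W' : Finset V'}, Pack G' c L W' → ∃ f, LocalIso G G' W f ∧ W.image f = W' := by
  induction h with
  | nil =>
    intro W' h'
    cases h'
    exact ⟨fun _ => Classical.arbitrary V', ⟨by simp, by simp⟩, by simp⟩
  | @cons x r A W L hc hA hs _ ih =>
    intro C h'
    cases h' with
    | @cons _ r' A' W' _ hc' hA' hs' hW' =>
      obtain ⟨f, hf, rfl, rfl⟩ := hA.exists_localIso hA'
      obtain ⟨g, hg, rfl⟩ := ih hW'
      obtain ⟨h1, h2⟩ := hf.glue hg hs.disjoint hs'.disjoint (fun a ha b hb =>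
        iff_of_false (hs a ha b hb).2
          (hs' _ (Finset.mem_image_of_mem f ha) _ (Finset.mem_image_of_mem g hb)).2)
      exact ⟨_, h1, h2⟩

theorem Pack.isIndContained {L : List ConsTree} {W : Finset V} {W' : Finset V'}
    (h : Pack G c L W) (h' : Pack G' c L W') :
    (G.induce (W : Set V)).IsIndContained G' := by
  -- The isomorphism is built as a total function into `V'`, which needs a default value. If `V'` is
  -- empty, so is the packing.
  rcases isEmpty_or_nonempty V' with hV | hV
  · have hL : L = [] := by
      cases h' with
      | nil => rfl
      | @cons _ r => exact hV.elim r
    subst hL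
    cases h
    exact ⟨⟨⟨fun v => absurd v.2 (by simp), fun v => absurd v.2 (by simp)⟩,
      fun {v} => absurd v.2 (by simp)⟩⟩
  · obtain ⟨f, hf, -⟩ := h.exists_localIso h'
    exact ⟨⟨⟨fun v => f v, fun v w e => Subtype.ext (hf.1 v.2 w.2 e)⟩,
      fun {v w} => (hf.2 v v.2 w w.2).symm⟩⟩

/-- The part of a packing that contains a given vertex. -/
theorem Pack.extract {L : List ConsTree} {W : Finset V} (h : Pack G c L W) {v : V} (hv : v ∈ W) :
    ∃ x L' r A W', L.Perm (x :: L') ∧ W = A ∪ W' ∧ Sep G A W' ∧ shapeSize x ≤ c ∧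
      IsTr G x r A ∧ Pack G c L' W' ∧ v ∈ A := by
  induction h with
  | nil => simp at hv
  | @cons x r A W L hc hA hs hW ih =>
    rcases Finset.mem_union.1 hv with hv | hv
    · exact ⟨x, L, r, A, W, .refl _, rfl, hs, hc, hA, hW, hv⟩
    · obtain ⟨y, L', r', A', W', hp, rfl, hs', hc', hA', hW', hv'⟩ := ih hv
      refine ⟨y, x :: L', r', A', A ∪ W', (hp.cons x).trans (.swap ..), ?_, ?_, hc', hA', ?_, hv'⟩
      · rw [Finset.union_left_comm]
      · exact (hs.mono subset_rfl Finset.subset_union_left).symm.union_right hs'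
      · exact .cons hc hA (hs.mono subset_rfl Finset.subset_union_right) hW'

/-- The shapes in a packing are determined, up to equivalence, by the set of vertices. -/
theorem Pack.perm_map {κ : Type} {f : ConsTree → κ}
    (hf : ∀ x y, shapeSize x ≤ c → shapeSize y ≤ c → ShapeEquiv x y → f x = f y)
    {L : List ConsTree} {W : Finset V} (h : Pack G c L W) :
    ∀ {L' : List ConsTree}, Pack G c L' W → (L.map f).Perm (L'.map f) := by
  induction h with
  | nil =>
    intro L' h'
    have := h'.length_le
    rw [Finset.card_empty, Nat.le_zero, List.length_eq_zero_iff] at this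
    rw [this]
  | @cons x r A W L hc hA hs hW ih =>
    intro L' h'
    obtain ⟨y, L'', s, B, W', hp, e, hs', hc', hB, hW', hv⟩ :=
      h'.extract (Finset.mem_union_left _ hA.root_mem)
    -- Both trees contain `r`. Each is connected, and the other one is separated from the rest of
    -- its own packing, so each contains the other.
    have hAB : A = B := by
      refine subset_antisymm ?_ ?_
      · exact hA.subset_of_mem (e ▸ Finset.subset_union_left) hs' hA.root_mem hv
      · exact hB.subset_of_mem (e ▸ Finset.subset_union_left) hs hv hA.root_mem
    subst hAB
    have hWW : W = W' := by
      rw [← Finset.union_sdiff_cancel_left hs.disjoint, e,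
        Finset.union_sdiff_cancel_left hs'.disjoint]
    subst hWW
    refine List.Perm.trans ?_ (hp.map f).symm
    rw [List.map_cons, List.map_cons, hf x y hc hc' (hA.shapeEquiv hB)]
    exact (ih hW').cons _

/-- Replacing the shapes in a packing by equivalent ones. -/
theorem Pack.map_shape {f : ConsTree → ConsTree}
    (hf : ∀ x, shapeSize x ≤ c → shapeSize (f x) ≤ c ∧ ShapeEquiv x (f x))
    {L : List ConsTree} {W : Finset V} (h : Pack G c L W) : Pack G c (L.map f) W := by
  induction h with
  | nil => exact .nil
  | cons hc hA hs _ ih =>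
    obtain ⟨h1, h2⟩ := hf _ hc
    obtain ⟨r, hr⟩ := (h2 _ _ _).1 ⟨_, hA⟩
    exact .cons h1 hr hs ih

/-- By connectedness, a tree inside `W` lies within a single tree of the packing. -/
theorem Pack.size_le_of_subset {L : List ConsTree} {W : Finset V} (h : Pack G c L W)
    {x : ConsTree} {r : V} {A : Finset V} (hA : IsTr G x r A) (hW : A ⊆ W) : shapeSize x ≤ c := by
  obtain ⟨y, L', s, B, W', -, rfl, hs, hc, hB, -, hr⟩ := h.extract (hW hA.root_mem)
  rw [← hA.card]
  exact (Finset.card_le_card (hA.subset_of_root hW hs hr)).trans (hB.card.trans_le hc)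

/-- Removing the root of a tree. -/
theorem IsTr.pack_erase {x : ConsTree} {r : V} {A : Finset V} (h : IsTr G x r A)
    (hc : shapeSize x ≤ c) : ∃ L, Pack G c L (A.erase r) := by
  induction h with
  | single r => exact ⟨[], by simpa using Pack.nil⟩
  | @graft x y r r' A B hA hB hd he ho ih₁ ih₂ =>
    simp only [shapeSize] at hc
    obtain ⟨L, hL⟩ := ih₁ (by omega)
    have hr : r ∉ B := Finset.disjoint_left.1 hd hA.root_mem
    refine ⟨L ++ [y], ?_⟩
    rw [Finset.erase_union_distrib, Finset.erase_eq_of_notMem hr]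
    refine hL.append (.singleton (by omega) hB) fun a ha b hb => ⟨?_, fun e => ?_⟩
    · rintro rfl
      exact Finset.disjoint_left.1 hd (Finset.mem_of_mem_erase ha) hb
    · exact (Finset.mem_erase.1 ha).1 (ho a (Finset.mem_of_mem_erase ha) b hb e).1

/-! ### Packings with a distinguished tree -/

/-- A packing on `W`, in which the tree that contains the root has been singled out. The root may be
missing (`r = none`), or it may lie outside `W` (`st = none`). -/
def RPack (G : SimpleGraph V) (c : ℕ) (r : Option V) (st : Option ConsTree) (L : List ConsTree)
    (W : Finset V) : Prop :=
  match st with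
  | none => (∀ v ∈ r, v ∉ W) ∧ Pack G c L W
  | some x => shapeSize x ≤ c ∧ ∃ v A W', r = some v ∧ W = A ∪ W' ∧ Sep G A W' ∧ IsTr G x v A ∧
      Pack G c L W'

/-- The shape of the distinguished tree, as a list. -/
theorem RPack.pack {r : Option V} {st : Option ConsTree} {L : List ConsTree} {W : Finset V}
    (h : RPack G c r st L W) : Pack G c (st.toList ++ L) W := by
  cases st with
  | none => exact h.2
  | some x =>
    obtain ⟨hc, v, A, W', -, rfl, hs, hA, hW⟩ := h
    exact .cons hc hA hs hW

/-- The edges between `B` and `B'` join the root `r` of `B` to the root `v` of `B'`. -/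
def Linked (G : SimpleGraph V) (B : Finset V) (r : Option V) (B' : Finset V) (v : V) : Prop :=
  Disjoint B B' ∧ (∀ u ∈ r, u ∈ B ∧ G.Adj u v) ∧
    (∀ a ∈ B, ∀ b ∈ B', G.Adj a b → r = some a ∧ b = v) ∧ v ∈ B'

section linked

variable {B B' W W' : Finset V} {r : Option V} {v : V} {L L' : List ConsTree}

/-- Every edge between the bags ends in `v`. -/
theorem Linked.sep_of_notMem (h : Linked G B r B' v) (hW : W ⊆ B) (hW' : W' ⊆ B')
    (hv : v ∉ W') : Sep G W W' := fun a ha b hb =>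
  ⟨fun e => Finset.disjoint_left.1 h.1 (hW ha) (e ▸ hW' hb), fun e =>
    hv ((h.2.2.1 a (hW ha) b (hW' hb) e).2 ▸ hb)⟩

/-- Every edge between the bags starts in the root of the first. -/
theorem Linked.sep_of_root_notMem (h : Linked G B r B' v) (hW : W ⊆ B) (hW' : W' ⊆ B')
    (hr : ∀ u ∈ r, u ∉ W) : Sep G W W' := fun a ha b hb =>
  ⟨fun e => Finset.disjoint_left.1 h.1 (hW ha) (e ▸ hW' hb), fun e =>
    hr a (h.2.2.1 a (hW ha) b (hW' hb) e).1 ha⟩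

/-- Joining a packing that avoids the second root. -/
theorem RPack.join_none (h : Linked G B r B' v) (hW : W ⊆ B) (hW' : W' ⊆ B') {st : Option ConsTree}
    (h₁ : RPack G c r st L W) (h₂ : RPack G c (some v) none L' W') :
    RPack G c r st (L ++ L') (W ∪ W') := by
  have hs := h.sep_of_notMem hW hW' (h₂.1 v rfl)
  cases st with
  | none =>
    refine ⟨fun u hu hu' => ?_, h₁.2.append h₂.2 hs⟩
    rcases Finset.mem_union.1 hu' with hu' | hu'
    · exact h₁.1 u hu hu'
    · exact Finset.disjoint_left.1 h.1 (h.2.1 u hu).1 (hW' hu')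
  | some x =>
    obtain ⟨hc, u, A, W₁, hr, rfl, hs', hA, hW₁⟩ := h₁
    refine ⟨hc, u, A, W₁ ∪ W', hr, by rw [Finset.union_assoc], ?_, hA, ?_⟩
    · exact hs'.union_right (hs.mono Finset.subset_union_left subset_rfl)
    · exact hW₁.append h₂.2 (hs.mono Finset.subset_union_right subset_rfl)

/-- Joining a packing that contains the second root to one that avoids the first. -/
theorem RPack.join_close (h : Linked G B r B' v) (hW : W ⊆ B) (hW' : W' ⊆ B') {y : ConsTree}
    (h₁ : RPack G c r none L W) (h₂ : RPack G c (some v) (some y) L' W') :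
    RPack G c r none (L ++ y :: L') (W ∪ W') := by
  have hs := h.sep_of_root_notMem hW hW' h₁.1
  refine ⟨fun u hu hu' => ?_, h₁.2.append h₂.pack hs⟩
  rcases Finset.mem_union.1 hu' with hu' | hu'
  · exact h₁.1 u hu hu'
  · exact Finset.disjoint_left.1 h.1 (h.2.1 u hu).1 (hW' hu')

/-- Joining two trees along the edge between the roots. -/
theorem Linked.graft (h : Linked G B r B' v) {x y : ConsTree} {u : V} {A A' : Finset V}
    (hr : r = some u) (hA : A ⊆ B) (hA' : A' ⊆ B') (hx : IsTr G x u A) (hy : IsTr G y v A') :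
    IsTr G (.cons y x) u (A ∪ A') := by
  subst hr
  refine .graft hx hy (h.1.mono hA hA') (h.2.1 u rfl).2 fun a ha b hb e => ?_
  obtain ⟨h1, h2⟩ := h.2.2.1 a (hA ha) b (hA' hb) e
  exact ⟨by simpa using h1.symm, h2⟩

/-- Both roots lie in the distinguished trees, so the linking edge merges these two and leaves all
other trees separated. -/
theorem RPack.join_graft (h : Linked G B r B' v) (hW : W ⊆ B) (hW' : W' ⊆ B') {x y : ConsTree}
    (hc : shapeSize x + shapeSize y ≤ c)
    (h₁ : RPack G c r (some x) L W) (h₂ : RPack G c (some v) (some y) L' W') :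
    RPack G c r (some (.cons y x)) (L ++ L') (W ∪ W') := by
  obtain ⟨-, u, A, W₁, hr, rfl, hs, hA, hW₁⟩ := h₁
  obtain ⟨-, v', A', W₂, hv, rfl, hs', hA', hW₂⟩ := h₂
  obtain rfl : v = v' := by simpa using hv
  have hAB := Finset.subset_union_left.trans hW
  have hWB := Finset.subset_union_right.trans hW
  have hAB' := Finset.subset_union_left.trans hW'
  have hWB' := Finset.subset_union_right.trans hW'
  have hv₂ : v ∉ W₂ := fun hv => (hs' v hA'.root_mem v hv).1 rfl
  have hu₁ : ∀ u' ∈ r, u' ∉ W₁ := by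
    rintro u' hu' hu
    obtain rfl : u = u' := by simpa [hr] using hu'
    exact (hs u hA.root_mem u hu).1 rfl
  refine ⟨hc, u, A ∪ A', W₁ ∪ W₂, hr, Finset.union_union_union_comm _ _ _ _, ?_,
    h.graft hr hAB hAB' hA hA', hW₁.append hW₂ (h.sep_of_notMem hWB hWB' hv₂)⟩
  refine Sep.union_left (hs.union_right (h.sep_of_notMem hAB hWB' hv₂)) (Sep.union_right ?_ hs')
  exact (h.sep_of_root_notMem hWB hAB' hu₁).symm

end linked

end packings


/-! ### Elimination of the leaves of a forest -/

/-- Every nonempty subset of `U` contains a vertex with at most one neighbour in that subset. -/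
def Degenerate {V : Type} (G : SimpleGraph V) (U : Finset V) : Prop :=
  ∀ S ⊆ U, S.Nonempty → ∃ v ∈ S, ∀ a ∈ S, ∀ b ∈ S, G.Adj v a → G.Adj v b → a = b

/-- The start of a longest path has no neighbour off the path, by maximality, and no neighbour on it
except the second vertex, by acyclicity. -/
theorem exists_leaf {V : Type} [Finite V] [Nonempty V] {G : SimpleGraph V} (h : G.IsAcyclic) :
    ∃ v, ∀ a b, G.Adj v a → G.Adj v b → a = b := by
  obtain ⟨u, v, p, hp, hmax⟩ := SimpleGraph.Walk.exists_isPath_forall_isPath_length_le_length G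
  have key : ∀ w, G.Adj u w → w = p.snd := by
    intro w hadj
    refine h.eq_snd_of_adj_start hp hadj ?_
    by_contra hw
    have := hmax _ _ _ (hp.cons (h := hadj.symm) hw)
    simp at this
  exact ⟨u, fun a b ha hb => (key a ha).trans (key b hb).symm⟩

theorem degenerate_of_isAcyclic {V : Type} {G : SimpleGraph V} (h : G.IsAcyclic) (U : Finset V) :
    Degenerate G U := by
  rintro S - ⟨s, hs⟩
  have : Nonempty (S : Set V) := ⟨⟨s, hs⟩⟩
  obtain ⟨v, hv⟩ := exists_leaf (h.induce (S : Set V))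
  refine ⟨v, v.2, fun a ha b hb h1 h2 => ?_⟩
  simpa using hv ⟨a, ha⟩ ⟨b, hb⟩ h1 h2

section elim

variable {V τ : Type} [DecidableEq V]

/-- Remove the vertex `p.1` with value `p.2`: the value is merged into that of the neighbour of
`p.1`, or into the global value if there is no neighbour. -/
def elimVertex (adj : V → V → Bool) (merge : τ → τ → τ) (s : List (V × τ) × τ) (p : V × τ) :
    List (V × τ) × τ :=
  if (s.1.filter fun q => !decide (q.1 = p.1)).any (fun q => adj p.1 q.1) then
    ((s.1.filter fun q => !decide (q.1 = p.1)).map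
      fun q => if adj p.1 q.1 then (q.1, merge q.2 p.2) else q, s.2)
  else (s.1.filter fun q => !decide (q.1 = p.1), merge s.2 p.2)

/-- Look for a vertex with at most one neighbour and remove it. -/
def elimStep (adj : V → V → Bool) (merge : τ → τ → τ) (s : List (V × τ) × τ) :
    List (V × τ) × τ :=
  (s.1.find? fun p => (s.1.filter fun q => adj p.1 q.1).tail.isEmpty).elim s
    (elimVertex adj merge s)

variable {G : SimpleGraph V} {Φ : Finset V → Option V → τ → Prop} {adj : V → V → Bool}
  {merge : τ → τ → τ} {U : Finset V}

/-- The invariant of the elimination: the vertices are distributed into a bag for each remaining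
vertex `p.1` and a bag `Z` of vertices in components that have been removed completely. -/
structure ElimInv (G : SimpleGraph V) (Φ : Finset V → Option V → τ → Prop) (U : Finset V)
    (s : List (V × τ) × τ) (bag : V → Finset V) (Z : Finset V) : Prop where
  nodup : (s.1.map Prod.fst).Nodup
  val : ∀ p ∈ s.1, Φ (bag p.1) (some p.1) p.2
  root : ∀ p ∈ s.1, p.1 ∈ bag p.1
  val_global : Φ Z none s.2
  cover : ∀ x, x ∈ U ↔ x ∈ Z ∨ ∃ p ∈ s.1, x ∈ bag p.1
  disj : ∀ p ∈ s.1, ∀ q ∈ s.1, p.1 ≠ q.1 → Disjoint (bag p.1) (bag q.1)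
  edge : ∀ p ∈ s.1, ∀ q ∈ s.1, p.1 ≠ q.1 → ∀ a ∈ bag p.1, ∀ b ∈ bag q.1, G.Adj a b →
    a = p.1 ∧ b = q.1
  sep : ∀ p ∈ s.1, Sep G Z (bag p.1)

/-- At most one edge leads from the bag of `p` to the other bags, namely from `p` to its remaining
neighbour. Merging the bag into that of the neighbour, or into `Z` if there is none, keeps all edges
between bags at the roots. -/
theorem ElimInv.vertex (hadj : ∀ a b, adj a b = true ↔ G.Adj a b)
    (hmerge : ∀ B r t B' v t', Linked G B r B' v → Φ B r t → Φ B' (some v) t' →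
      Φ (B ∪ B') r (merge t t'))
    {s : List (V × τ) × τ} {bag : V → Finset V} {Z : Finset V} (h : ElimInv G Φ U s bag Z)
    {p : V × τ} (hp : p ∈ s.1)
    (hone : ∀ q ∈ s.1, ∀ q' ∈ s.1, G.Adj p.1 q.1 → G.Adj p.1 q'.1 → q.1 = q'.1) :
    ∃ bag' Z', ElimInv G Φ U (elimVertex adj merge s p) bag' Z' := by
  set R := s.1.filter fun q => !decide (q.1 = p.1) with hR
  have hmem : ∀ q, q ∈ R ↔ q ∈ s.1 ∧ q.1 ≠ p.1 := by simp [hR]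
  have hnd : (R.map Prod.fst).Nodup := h.nodup.sublist (List.filter_sublist.map _)
  have huniq : ∀ q ∈ s.1, q.1 = p.1 → q = p := fun q hq e =>
    List.inj_on_of_nodup_map h.nodup hq hp e
  by_cases hex : R.any (fun q => adj p.1 q.1) = true
  · obtain ⟨u, hu, hup⟩ := List.any_eq_true.1 hex
    rw [hadj] at hup
    obtain ⟨hus, hune⟩ := (hmem u).1 hu
    have hadju : ∀ q ∈ R, adj p.1 q.1 = true ↔ q.1 = u.1 := by
      intro q hq
      rw [hadj]
      exact ⟨fun e => hone q ((hmem q).1 hq).1 u hus e hup, fun e => e ▸ hup⟩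
    let bag' : V → Finset V := fun w => if w = u.1 then bag u.1 ∪ bag p.1 else bag w
    have hu' : bag' u.1 = bag u.1 ∪ bag p.1 := if_pos rfl
    have hne' : ∀ w, w ≠ u.1 → bag' w = bag w := fun w hw => if_neg hw
    have hkeys : ∀ q', q' ∈ (elimVertex adj merge s p).1 ↔ ∃ q ∈ R,
        q' = if q.1 = u.1 then (q.1, merge q.2 p.2) else q := by
      intro q'
      unfold elimVertex
      rw [if_pos hex, ← hR]
      simp only [List.mem_map]
      refine exists_congr fun q => and_congr_right fun hq => ?_
      rw [eq_comm]
      by_cases e : q.1 = u.1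
      · rw [if_pos e, if_pos ((hadju q hq).2 e)]
      · rw [if_neg e, if_neg (fun e' => e ((hadju q hq).1 e'))]
    have hkey : ∀ q ∈ (elimVertex adj merge s p).1, ∃ q' ∈ R, q.1 = q'.1 := by
      intro q hq
      obtain ⟨q', hq', rfl⟩ := (hkeys q).1 hq
      refine ⟨q', hq', ?_⟩
      split_ifs <;> rfl
    have hkey' : ∀ q ∈ R, ∃ q' ∈ (elimVertex adj merge s p).1, q'.1 = q.1 := by
      intro q hq
      refine ⟨_, (hkeys _).2 ⟨q, hq, rfl⟩, ?_⟩
      split_ifs <;> rfl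
    have hglob : (elimVertex adj merge s p).2 = s.2 := by
      unfold elimVertex
      rw [if_pos hex]
    have hsub : ∀ w, bag w ⊆ bag' w := by
      intro w
      by_cases e : w = u.1
      · subst e; rw [hu']; exact Finset.subset_union_left
      · rw [hne' w e]
    have hedge : ∀ q ∈ R, q.1 ≠ u.1 → ∀ a ∈ bag u.1 ∪ bag p.1, ∀ b ∈ bag q.1, G.Adj a b →
        a = u.1 ∧ b = q.1 := by
      intro q hq hqu a ha b hb e
      obtain ⟨hqs, hqp⟩ := (hmem q).1 hq
      rcases Finset.mem_union.1 ha with ha | ha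
      · exact h.edge u hus q hqs (Ne.symm hqu) a ha b hb e
      -- An edge from the bag of `p` to a third bag would give `p` a second remaining neighbour.
      · obtain ⟨rfl, rfl⟩ := h.edge p hp q hqs (Ne.symm hqp) a ha b hb e
        exact absurd (hone q hqs u hus e hup) hqu
    refine ⟨bag', Z, ?_, ?_, ?_, ?_, ?_, ?_, ?_, ?_⟩
    · have : (elimVertex adj merge s p).1.map Prod.fst = R.map Prod.fst := by
        unfold elimVertex
        rw [if_pos hex, ← hR]
        rw [List.map_map]
        refine List.map_congr_left fun q _ => ?_
        simp only [Function.comp]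
        split_ifs <;> rfl
      rwa [this]
    · intro q hq
      obtain ⟨q', hq', rfl⟩ := (hkeys q).1 hq
      obtain ⟨hqs, hqp⟩ := (hmem q').1 hq'
      split_ifs with e
      · have : q' = u := List.inj_on_of_nodup_map h.nodup hqs hus e
        subst this
        change Φ (bag' q'.1) (some q'.1) (merge q'.2 p.2)
        rw [hu']
        refine hmerge _ _ _ _ _ _ ⟨h.disj _ hus _ hp hune, ?_, ?_, h.root p hp⟩ (h.val _ hus)
          (h.val p hp)
        · rintro _ ⟨⟩
          exact ⟨h.root _ hus, hup.symm⟩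
        · intro a ha b hb e
          obtain ⟨rfl, rfl⟩ := h.edge _ hus p hp hune a ha b hb e
          exact ⟨rfl, rfl⟩
      · rw [hne' _ e]
        exact h.val _ hqs
    · intro q hq
      obtain ⟨q', hq', e⟩ := hkey q hq
      rw [e]
      exact hsub _ (h.root q' ((hmem q').1 hq').1)
    · rw [hglob]
      exact h.val_global
    · intro x
      rw [h.cover]
      refine or_congr_right ⟨?_, ?_⟩
      · rintro ⟨q, hq, hx⟩
        by_cases e : q.1 = p.1
        · obtain ⟨q', hq', e'⟩ := hkey' u hu
          refine ⟨q', hq', ?_⟩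
          rw [e', hu', ← e]
          exact Finset.mem_union_right _ hx
        · obtain ⟨q', hq', e'⟩ := hkey' q ((hmem q).2 ⟨hq, e⟩)
          refine ⟨q', hq', ?_⟩
          rw [e']
          exact hsub _ hx
      · rintro ⟨q, hq, hx⟩
        obtain ⟨q', hq', e⟩ := hkey q hq
        rw [e] at hx
        by_cases e' : q'.1 = u.1
        · rw [e', hu'] at hx
          rcases Finset.mem_union.1 hx with hx | hx
          · exact ⟨u, hus, hx⟩
          · exact ⟨p, hp, hx⟩
        · rw [hne' _ e'] at hx
          exact ⟨q', ((hmem q').1 hq').1, hx⟩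
    · intro q₁ hq₁ q₂ hq₂ hne
      obtain ⟨r₁, hr₁, e₁⟩ := hkey q₁ hq₁
      obtain ⟨r₂, hr₂, e₂⟩ := hkey q₂ hq₂
      rw [e₁, e₂] at hne ⊢
      obtain ⟨hs₁, hp₁⟩ := (hmem r₁).1 hr₁
      obtain ⟨hs₂, hp₂⟩ := (hmem r₂).1 hr₂
      by_cases c₁ : r₁.1 = u.1
      · have c₂ : r₂.1 ≠ u.1 := fun e => hne (c₁.trans e.symm)
        rw [c₁, hu', hne' _ c₂, Finset.disjoint_union_left]
        exact ⟨h.disj u hus r₂ hs₂ c₂.symm, h.disj p hp r₂ hs₂ hp₂.symm⟩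
      · by_cases c₂ : r₂.1 = u.1
        · rw [c₂, hu', hne' _ c₁, Finset.disjoint_union_right]
          exact ⟨h.disj r₁ hs₁ u hus c₁, h.disj r₁ hs₁ p hp hp₁⟩
        · rw [hne' _ c₁, hne' _ c₂]
          exact h.disj r₁ hs₁ r₂ hs₂ hne
    · intro q₁ hq₁ q₂ hq₂ hne
      obtain ⟨r₁, hr₁, e₁⟩ := hkey q₁ hq₁
      obtain ⟨r₂, hr₂, e₂⟩ := hkey q₂ hq₂
      rw [e₁, e₂] at hne ⊢
      obtain ⟨hs₁, hp₁⟩ := (hmem r₁).1 hr₁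
      obtain ⟨hs₂, hp₂⟩ := (hmem r₂).1 hr₂
      by_cases c₁ : r₁.1 = u.1
      · have c₂ : r₂.1 ≠ u.1 := fun e => hne (c₁.trans e.symm)
        rw [c₁, hu', hne' _ c₂]
        exact hedge r₂ hr₂ c₂
      · by_cases c₂ : r₂.1 = u.1
        · rw [c₂, hu', hne' _ c₁]
          intro a ha b hb e
          exact (hedge r₁ hr₁ c₁ b hb a ha e.symm).symm
        · rw [hne' _ c₁, hne' _ c₂]
          exact h.edge r₁ hs₁ r₂ hs₂ hne
    · intro q hq
      obtain ⟨r, hr, e⟩ := hkey q hq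
      rw [e]
      by_cases e' : r.1 = u.1
      · rw [e', hu']
        exact (h.sep u hus).union_right (h.sep p hp)
      · rw [hne' _ e']
        exact h.sep r ((hmem r).1 hr).1
  · have hs : elimVertex adj merge s p = (R, merge s.2 p.2) := by
      unfold elimVertex
      rw [if_neg hex]
    have hno : ∀ q ∈ R, ¬ G.Adj p.1 q.1 := by
      intro q hq e
      exact hex (List.any_eq_true.2 ⟨q, hq, (hadj _ _).2 e⟩)
    rw [hs]
    refine ⟨bag, Z ∪ bag p.1, hnd, ?_, ?_, ?_, ?_, ?_, ?_, ?_⟩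
    · exact fun q hq => h.val q ((hmem q).1 hq).1
    · exact fun q hq => h.root q ((hmem q).1 hq).1
    -- Without a root on the left, the edge condition of `Linked` forbids all edges between `Z` and
    -- the bag of `p`.
    · refine hmerge _ _ _ _ _ _ ⟨(h.sep p hp).disjoint, by simp, ?_, h.root p hp⟩ h.val_global
        (h.val p hp)
      exact fun a ha b hb e => absurd e (h.sep p hp a ha b hb).2
    · intro x
      rw [h.cover, Finset.mem_union, or_assoc]
      refine or_congr_right ⟨?_, ?_⟩
      · rintro ⟨q, hq, hx⟩
        by_cases e : q.1 = p.1
        · exact Or.inl (e ▸ hx)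
        · exact Or.inr ⟨q, (hmem q).2 ⟨hq, e⟩, hx⟩
      · rintro (hx | ⟨q, hq, hx⟩)
        · exact ⟨p, hp, hx⟩
        · exact ⟨q, ((hmem q).1 hq).1, hx⟩
    · exact fun q hq q' hq' => h.disj q ((hmem q).1 hq).1 q' ((hmem q').1 hq').1
    · exact fun q hq q' hq' => h.edge q ((hmem q).1 hq).1 q' ((hmem q').1 hq').1
    · intro q hq
      obtain ⟨hqs, hqp⟩ := (hmem q).1 hq
      refine (h.sep q hqs).union_left fun a ha b hb => ⟨?_, fun e => ?_⟩
      · rintro rfl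
        exact Finset.disjoint_left.1 (h.disj p hp q hqs hqp.symm) ha hb
      · obtain ⟨rfl, rfl⟩ := h.edge p hp q hqs hqp.symm a ha b hb e
        exact hno q hq e

theorem length_elimVertex_lt {s : List (V × τ) × τ} {p : V × τ} (hp : p ∈ s.1) :
    (elimVertex adj merge s p).1.length < s.1.length := by
  have : (s.1.filter fun q => !decide (q.1 = p.1)).length < s.1.length :=
    List.length_filter_lt_length_iff_exists.2 ⟨p, hp, by simp⟩
  unfold elimVertex
  split_ifs
  · simpa using this
  · exact this

omit [DecidableEq V] in
theorem length_filter_le_one {l : List V} (hl : l.Nodup) {f : V → Bool}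
    (h : ∀ a ∈ l, ∀ b ∈ l, f a = true → f b = true → a = b) : (l.filter f).tail = [] := by
  have hn := hl.filter f
  have hm : ∀ a ∈ l.filter f, ∀ b ∈ l.filter f, a = b := by
    intro a ha b hb
    rw [List.mem_filter] at ha hb
    exact h a ha.1 b hb.1 ha.2 hb.2
  generalize l.filter f = k at hn hm
  rcases k with _ | ⟨a, _ | ⟨b, m⟩⟩
  · rfl
  · rfl
  · have := hm a (by simp) b (by simp)
    subst this
    simp at hn

theorem tail_eq_nil_subsingleton {α : Type} {l : List α} (h : l.tail = []) {a b : α} (ha : a ∈ l)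
    (hb : b ∈ l) : a = b := by
  rcases l with _ | ⟨c, _ | ⟨d, m⟩⟩
  · simp at ha
  · simp at ha hb; rw [ha, hb]
  · simp at h

/-- What the elimination computes. -/
theorem elim_correct (hadj : ∀ a b, adj a b = true ↔ G.Adj a b) {init : V → τ} {t₀ : τ}
    (hinit : ∀ v, Φ {v} (some v) (init v)) (hzero : Φ ∅ none t₀)
    (hmerge : ∀ B r t B' v t', Linked G B r B' v → Φ B r t → Φ B' (some v) t' →
      Φ (B ∪ B') r (merge t t'))
    {l : List V} (hl : l.Nodup) (hG : Degenerate G l.toFinset) {n : ℕ} (hn : l.length ≤ n) :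
    Φ l.toFinset none ((elimStep adj merge)^[n] (l.map fun v => (v, init v), t₀)).2 := by
  have key : ∀ i, ∃ bag Z, ElimInv G Φ l.toFinset
      ((elimStep adj merge)^[i] (l.map fun v => (v, init v), t₀)) bag Z ∧
      ((elimStep adj merge)^[i] (l.map fun v => (v, init v), t₀)).1.length ≤ l.length - i := by
    intro i
    induction i with
    | zero =>
      refine ⟨fun v => {v}, ∅, ⟨?_, ?_, ?_, hzero, ?_, ?_, ?_, ?_⟩, by simp⟩
      · simpa [Function.comp_def] using hl
      · simpa using fun a _ => hinit a
      · simp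
      · intro x; simp
      · intro p _ q _ h; simpa using h
      · intro p _ q _ _ a ha b hb _
        exact ⟨by simpa using ha, by simpa using hb⟩
      · intro p _; exact fun a ha => by simp at ha
    | succ i ih =>
      obtain ⟨bag, Z, h, hlen⟩ := ih
      rw [Function.iterate_succ_apply']
      set s := (elimStep adj merge)^[i] (l.map fun v => (v, init v), t₀) with hs
      unfold elimStep
      have hfil : ∀ p : V × τ, (s.1.filter fun q => adj p.1 q.1).tail = [] ↔
          ((s.1.map Prod.fst).filter fun a => adj p.1 a).tail = [] := by
        intro p
        rw [List.filter_map, ← List.map_tail, List.map_eq_nil_iff]; rfl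
      cases hf : s.1.find? fun p => (s.1.filter fun q => adj p.1 q.1).tail.isEmpty with
      | some p =>
        have hp := List.mem_of_find?_eq_some hf
        have hone := List.find?_some hf
        rw [List.isEmpty_iff] at hone
        obtain ⟨bag', Z', h'⟩ := h.vertex hadj hmerge hp (fun q hq q' hq' e e' => by
          rw [tail_eq_nil_subsingleton hone (a := q) (b := q')
            (List.mem_filter.2 ⟨hq, (hadj _ _).2 e⟩) (List.mem_filter.2 ⟨hq', (hadj _ _).2 e'⟩)])
        refine ⟨bag', Z', h', ?_⟩
        have := length_elimVertex_lt (adj := adj) (merge := merge) hp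
        simp only [Option.elim]
        omega
      | none =>
        refine ⟨bag, Z, h, ?_⟩
        simp only [Option.elim]
        rcases Nat.eq_zero_or_pos s.1.length with h0 | h0
        · omega
        -- The search cannot fail while vertices remain: they form a nonempty subset of `U`, so by
        -- degeneracy one of them has at most one neighbour among them.
        · exfalso
          obtain ⟨v, hv, hv'⟩ := hG (s.1.map Prod.fst).toFinset (fun x hx => by
            simp only [List.mem_toFinset, List.mem_map] at hx
            obtain ⟨p, hp, rfl⟩ := hx
            exact (h.cover _).2 (Or.inr ⟨p, hp, h.root p hp⟩)) (by
              obtain ⟨p, hp⟩ := List.exists_mem_of_length_pos h0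
              exact ⟨p.1, by simpa using ⟨_, hp⟩⟩)
          simp only [List.mem_toFinset] at hv hv'
          obtain ⟨p, hp, rfl⟩ := List.mem_map.1 hv
          have := List.find?_eq_none.1 hf p hp
          apply this
          rw [List.isEmpty_iff, hfil]
          exact length_filter_le_one h.nodup fun a ha b hb e e' =>
            hv' a ha b hb ((hadj _ _).1 e) ((hadj _ _).1 e')
  obtain ⟨bag, Z, h, hlen⟩ := key n
  have h0 : ((elimStep adj merge)^[n] (l.map fun v => (v, init v), t₀)).1 = [] :=
    List.length_eq_zero_iff.1 (by omega)
  have hZ : l.toFinset = Z := by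
    ext x
    rw [h.cover, h0]
    simp
  rw [hZ]
  exact h.val_global

end elim

/-! ### Cutting a forest into components of bounded order -/

/-- A forest of order `n` has an induced subforest of order at least `n - n / (c + 1)` all of whose
components have order at most `c`. -/
theorem exists_pack {V : Type} [Fintype V] [DecidableEq V] {G : SimpleGraph V} (hG : G.IsAcyclic)
    {c : ℕ} (hc : 1 ≤ c) : ∃ (L : List ConsTree) (W : Finset V), Pack G c L W ∧
      c * Fintype.card V ≤ (c + 1) * W.card := by
  classical
  -- The values carry no information; the invariant asserts that a good `W` exists. Each vertex of
  -- the bag costs `c`, each kept vertex pays `c + 1`, and the order of the tree at the root is held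
  -- back as credit.
  have := elim_correct (G := G) (τ := Unit) (adj := fun a b => decide (G.Adj a b))
    (merge := fun _ _ => ()) (init := fun _ => ()) (t₀ := ()) (Φ := fun B r _ =>
      ∃ (st : Option ConsTree) (L : List ConsTree) (W : Finset V), W ⊆ B ∧ RPack G c r st L W ∧
        c * B.card + st.elim 0 shapeSize ≤ (c + 1) * W.card) (by simp) ?_ ?_ ?_
        (l := Finset.univ.toList) (Finset.nodup_toList _) (degenerate_of_isAcyclic hG _) le_rfl
  · obtain ⟨st, L, W, -, h, hcard⟩ := this
    refine ⟨_, W, h.pack, ?_⟩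
    rw [Finset.toList_toFinset, Finset.card_univ] at hcard
    omega
  · intro v
    refine ⟨some .nil, [], {v}, subset_rfl, ⟨hc, v, {v}, ∅, rfl, by simp, sep_empty _, .single v,
      .nil⟩, ?_⟩
    simp [shapeSize]
  · exact ⟨none, [], ∅, subset_rfl, ⟨by simp, .nil⟩, by simp⟩
  · rintro B r - B' v - hl ⟨st, L, W, hW, h, hcard⟩ ⟨st', L', W', hW', h', hcard'⟩
    have hdis : Disjoint W W' := hl.1.mono hW hW'
    have hsub := Finset.union_subset_union hW hW'
    have hcB := Finset.card_union_of_disjoint hl.1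
    have hcW := Finset.card_union_of_disjoint hdis
    cases st' with
    | none =>
      refine ⟨st, _, _, hsub, h.join_none hl hW hW' h', ?_⟩
      rw [hcB, hcW]
      simp only [Option.elim_none] at hcard'
      rw [mul_add, mul_add]
      omega
    | some y =>
      cases st with
      | none =>
        refine ⟨none, _, _, hsub, h.join_close hl hW hW' h', ?_⟩
        rw [hcB, hcW]
        simp only [Option.elim] at hcard hcard' ⊢
        rw [mul_add, mul_add]
        omega
      | some x =>
        by_cases hxy : shapeSize x + shapeSize y ≤ c
        · refine ⟨_, _, _, hsub, h.join_graft hl hW hW' hxy h', ?_⟩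
          rw [hcB, hcW]
          simp only [Option.elim, shapeSize] at hcard hcard' ⊢
          rw [mul_add, mul_add]
          omega
        -- The joined tree would have at least `c + 1` vertices. Deleting `u` loses a payment of `c
        -- + 1`, which the credits of the two trees cover; the rest of the tree of `u` falls apart
        -- into smaller trees.
        · obtain ⟨hx, u, A, W₁, rfl, rfl, hs, hA, hW₁⟩ := h
          obtain ⟨L₁, hL₁⟩ := hA.pack_erase hx
          have hu : u ∉ W₁ := fun hu => (hs u hA.root_mem u hu).1 rfl
          have hr : RPack G c (some u) none (L₁ ++ L) (A.erase u ∪ W₁) := by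
            refine ⟨?_, hL₁.append hW₁ (hs.mono (Finset.erase_subset _ _) subset_rfl)⟩
            rintro v ⟨⟩
            simp [hu]
          have hW₂ : A.erase u ∪ W₁ ⊆ B :=
            (Finset.union_subset_union (Finset.erase_subset _ _) subset_rfl).trans hW
          refine ⟨none, _, _, Finset.union_subset_union hW₂ hW', hr.join_close hl hW₂ hW' h', ?_⟩
          have e1 : (A.erase u ∪ W₁).card + 1 = (A ∪ W₁).card := by
            rw [Finset.card_union_of_disjoint hs.disjoint, Finset.card_union_of_disjoint
              (hs.disjoint.mono_left (Finset.erase_subset _ _)), ← Finset.card_erase_add_one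
              hA.root_mem]
            omega
          rw [hcB, Finset.card_union_of_disjoint (hl.1.mono hW₂ hW')]
          simp only [Option.elim] at hcard hcard' ⊢
          rw [← e1, mul_add] at hcard
          rw [mul_add, mul_add]
          omega


/-! ### Classes of shapes -/

/-- Shapes of order at most `c`. -/
abbrev Shape (c : ℕ) : Type := {x : ConsTree // shapeSize x ≤ c}

instance (c : ℕ) : Finite (Shape c) := (finite_shapes c).to_subtype

/-- The number of shapes of order at most `c`. -/
noncomputable def numShapes (c : ℕ) : ℕ := Nat.card (Shape c)

/-- A numbering of the shapes. -/
noncomputable def shapeEquivFin (c : ℕ) : Shape c ≃ Fin (numShapes c) := Finite.equivFin _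

/-- The shape with a given number. -/
noncomputable def shape {c : ℕ} (i : Fin (numShapes c)) : ConsTree := ((shapeEquivFin c).symm i).1

/-- Equivalence of shapes of order at most `c`. -/
def shapeSetoid (c : ℕ) : Setoid (Shape c) :=
  ⟨fun x y => ShapeEquiv x.1 y.1, fun x => ShapeEquiv.equivalence.refl x.1,
    fun h => ShapeEquiv.equivalence.symm h, fun h h' => ShapeEquiv.equivalence.trans h h'⟩

/-- The number of isomorphism classes of trees of order at most `c`. -/
noncomputable def numClasses (c : ℕ) : ℕ := Nat.card (Quotient (shapeSetoid c))

/-- A numbering of the isomorphism classes. -/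
noncomputable def classEquivFin (c : ℕ) : Quotient (shapeSetoid c) ≃ Fin (numClasses c) :=
  Finite.equivFin _

/-- The class of a shape (`none` if the shape is too large). -/
noncomputable def classOf (c : ℕ) (x : ConsTree) : Option (Fin (numClasses c)) :=
  if h : shapeSize x ≤ c then some (classEquivFin c (Quotient.mk _ ⟨x, h⟩)) else none

/-- A representative of a class. -/
noncomputable def rep {c : ℕ} (q : Fin (numClasses c)) : Shape c := ((classEquivFin c).symm q).out

theorem classOf_rep {c : ℕ} (q : Fin (numClasses c)) : classOf c (rep q).1 = some q := by
  have h : Quotient.mk (shapeSetoid c) (rep q) = (classEquivFin c).symm q := Quotient.out_eq _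
  rw [classOf, dif_pos (rep q).2]
  change some (classEquivFin c (Quotient.mk (shapeSetoid c) (rep q))) = _
  rw [h, Equiv.apply_symm_apply]

theorem classOf_eq {c : ℕ} {x y : ConsTree} (hx : shapeSize x ≤ c) (hy : shapeSize y ≤ c)
    (h : ShapeEquiv x y) : classOf c x = classOf c y := by
  rw [classOf, classOf, dif_pos hx, dif_pos hy]
  congr 2
  exact Quotient.sound h

theorem shapeEquiv_rep {c : ℕ} {x : ConsTree} (hx : shapeSize x ≤ c) :
    ∃ q, classOf c x = some q ∧ ShapeEquiv x (rep q).1 := by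
  refine ⟨_, dif_pos hx, ?_⟩
  have h : Quotient.mk (shapeSetoid c) (rep (classEquivFin c (Quotient.mk _ ⟨x, hx⟩))) =
      Quotient.mk (shapeSetoid c) ⟨x, hx⟩ := by
    rw [rep, Quotient.out_eq, Equiv.symm_apply_apply]
  exact ShapeEquiv.equivalence.symm (Quotient.exact h)

/-- The multiplicities of the classes in a list of shapes. -/
noncomputable def multVec (c : ℕ) (L : List ConsTree) : Fin (numClasses c) → ℕ :=
  fun q => (L.map (classOf c)).count (some q)

theorem multVec_nil (c : ℕ) : multVec c [] = 0 := by
  funext q; simp [multVec]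

theorem multVec_append (c : ℕ) (L L' : List ConsTree) :
    multVec c (L ++ L') = multVec c L + multVec c L' := by
  funext q; simp [multVec]

theorem multVec_le (c : ℕ) (L : List ConsTree) (q : Fin (numClasses c)) :
    multVec c L q ≤ L.length := by
  have := List.count_le_length (a := some q) (l := L.map (classOf c))
  simpa [multVec] using this

/-- The multiplicities are determined by the set of vertices of a packing. -/
theorem Pack.multVec_eq {V : Type} [DecidableEq V] {G : SimpleGraph V} {c : ℕ}
    {L L' : List ConsTree} {W : Finset V} (h : Pack G c L W) (h' : Pack G c L' W) :
    multVec c L = multVec c L' := by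
  funext q
  exact (h.perm_map (fun _ _ => classOf_eq) h').count_eq _

/-- The multiplicities determine the graph that a packing induces. -/
theorem Pack.exists_common {V V' : Type} [DecidableEq V] [DecidableEq V']
    {G : SimpleGraph V} {G' : SimpleGraph V'} {c : ℕ} {L L' : List ConsTree} {W : Finset V}
    {W' : Finset V'} (h : Pack G c L W) (h' : Pack G' c L' W')
    (e : multVec c L = multVec c L') : ∃ M, Pack G c M W ∧ Pack G' c M W' := by
  -- Once shapes are replaced by representatives of their classes, equal multiplicities make the two
  -- lists permutations of each other.
  let f : ConsTree → ConsTree := fun x => (classOf c x).elim x fun q => (rep q).1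
  have hf : ∀ x, shapeSize x ≤ c → shapeSize (f x) ≤ c ∧ ShapeEquiv x (f x) := by
    intro x hx
    obtain ⟨q, hq, hxq⟩ := shapeEquiv_rep hx
    simp only [f, hq, Option.elim_some]
    exact ⟨(rep q).2, hxq⟩
  have hmap : ∀ M : List ConsTree, (∀ x ∈ M, shapeSize x ≤ c) →
      M.map f = (M.map (classOf c)).map fun o => o.elim .nil fun q => (rep q).1 := by
    intro M hM
    rw [List.map_map]
    refine List.map_congr_left fun x hx => ?_
    obtain ⟨q, hq, -⟩ := shapeEquiv_rep (hM x hx)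
    simp [f, hq]
  have hperm : (L.map (classOf c)).Perm (L'.map (classOf c)) := by
    rw [List.perm_iff_count]
    -- The value `none` does not occur, since all shapes in a packing have order at most `c`.
    rintro (_ | q)
    · have hnone : ∀ M : List ConsTree, (∀ x ∈ M, shapeSize x ≤ c) →
          (M.map (classOf c)).count none = 0 := by
        intro M hM
        rw [List.count_eq_zero]
        intro hn
        obtain ⟨x, hx, hn⟩ := List.mem_map.1 hn
        obtain ⟨q, hq, -⟩ := shapeEquiv_rep (hM x hx)
        rw [hq] at hn
        cases hn
      rw [hnone L h.size_le, hnone L' h'.size_le]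
    · exact congrFun e q
  have h1 := h.map_shape hf
  have h2 := h'.map_shape hf
  rw [hmap L h.size_le] at h1
  rw [hmap L' h'.size_le] at h2
  exact ⟨_, h1, h2.perm (hperm.map _).symm⟩

/-! ### The dynamic program -/

/-- Entries of the tables: the shape of the tree that contains the root, and the multiplicities of
the other trees. -/
abbrev Entry (c : ℕ) : Type := Option (Fin (numShapes c)) × (Fin (numClasses c) → ℕ)

/-- The effect of linking two roots: the new shape at the root, and the tree that is completed. -/
noncomputable def linkStates {c : ℕ} : Option (Fin (numShapes c)) → Option (Fin (numShapes c)) →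
    Option (Entry c)
  | s, none => some (s, 0)
  | none, some j => some (none, multVec c [shape j])
  | some i, some j =>
    if h : shapeSize (.cons (shape j) (shape i)) ≤ c then
      some (some (shapeEquivFin c ⟨.cons (shape j) (shape i), h⟩), 0)
    else none

/-- The entry that results from linking two roots. -/
noncomputable def linkEntries {c : ℕ} (a b : Entry c) : Option (Entry c) :=
  (linkStates a.1 b.1).map fun r => (r.1, a.2 + b.2 + r.2)

/-- All entries with multiplicities at most `n`. -/
noncomputable def allEntries (c n : ℕ) : List (Entry c) :=
  (none :: (List.finRange (numShapes c)).map some).flatMap fun s =>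
    (vecsUpTo (numClasses c) n).map fun v => (s, v)

theorem mem_allEntries {c n : ℕ} {a : Entry c} : a ∈ allEntries c n ↔ ∀ q, a.2 q ≤ n := by
  obtain ⟨s, v⟩ := a
  simp only [allEntries, List.mem_flatMap, List.mem_map, Prod.mk.injEq]
  constructor
  · rintro ⟨_, _, w, hw, _, rfl⟩
    exact mem_vecsUpTo.1 hw
  · intro h
    refine ⟨s, ?_, v, mem_vecsUpTo.2 h, rfl, rfl⟩
    cases s <;> simp

/-- The table that results from linking two roots. -/
noncomputable def mergeTables (c n : ℕ) (T T' : List (Entry c)) : List (Entry c) :=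
  (allEntries c n).filter fun x => T.any fun a => T'.any fun b => decide (linkEntries a b = some x)

theorem mem_mergeTables {c n : ℕ} {T T' : List (Entry c)} {x : Entry c} :
    x ∈ mergeTables c n T T' ↔
      (∀ q, x.2 q ≤ n) ∧ ∃ a ∈ T, ∃ b ∈ T', linkEntries a b = some x := by
  simp [mergeTables, mem_allEntries]

/-- The table of a single vertex. -/
noncomputable def initTable (c : ℕ) : List (Entry c) :=
  (none, 0) :: if h : shapeSize .nil ≤ c then [(some (shapeEquivFin c ⟨.nil, h⟩), 0)] else []

/-- Every tree that is induced on a subset of `W` has order at most `c`. -/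
def BoundedTrees {V : Type} [DecidableEq V] (G : SimpleGraph V) (c : ℕ) (W : Finset V) : Prop :=
  ∀ x r A, IsTr G x r A → A ⊆ W → shapeSize x ≤ c

/-- The entries of `T` describe all packings of trees of order at most `c` inside `B`. -/
def TableSpec {V : Type} [DecidableEq V] (G : SimpleGraph V) (c n : ℕ) (B : Finset V)
    (r : Option V) (T : List (Entry c)) : Prop :=
  (∀ a ∈ T, ∃ L W, W ⊆ B ∧ RPack G c r (a.1.map shape) L W ∧ a.2 = multVec c L) ∧
  ∀ W ⊆ B, BoundedTrees G c W → W.card ≤ n →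
    ∃ a ∈ T, ∃ L, RPack G c r (a.1.map shape) L W ∧ a.2 = multVec c L

section dp

variable {V : Type} [DecidableEq V] {G : SimpleGraph V} {c n : ℕ}

theorem shape_shapeEquivFin (x : Shape c) : shape (shapeEquivFin c x) = x.1 := by
  rw [shape, Equiv.symm_apply_apply]

theorem tableSpec_init (hc : 1 ≤ c) (v : V) : TableSpec G c n {v} (some v) (initTable c) := by
  have hnone : RPack G c (some v) none [] ∅ := ⟨by simp, .nil⟩
  have hsome : RPack G c (some v) (some .nil) [] {v} :=
    ⟨hc, v, {v}, ∅, rfl, by simp, sep_empty _, .single v, .nil⟩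
  have hT : initTable c = [(none, 0), (some (shapeEquivFin c ⟨.nil, hc⟩), 0)] := by
    rw [initTable, dif_pos (show shapeSize .nil ≤ c from hc)]
  rw [hT]
  constructor
  · intro a ha
    simp only [List.mem_cons, List.not_mem_nil, or_false] at ha
    rcases ha with rfl | rfl
    · exact ⟨[], ∅, by simp, hnone, (multVec_nil c).symm⟩
    · refine ⟨[], {v}, subset_rfl, ?_, (multVec_nil c).symm⟩
      simpa [shape_shapeEquivFin] using hsome
  · intro W hW _ _
    rcases Finset.subset_singleton_iff.1 hW with rfl | rfl
    · exact ⟨(none, 0), by simp, [], hnone, (multVec_nil c).symm⟩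
    · refine ⟨(some (shapeEquivFin c ⟨.nil, hc⟩), 0), by simp, [], ?_, (multVec_nil c).symm⟩
      simpa [shape_shapeEquivFin] using hsome

theorem tableSpec_empty : TableSpec G c n ∅ none [(none, 0)] := by
  constructor
  · intro a ha
    rw [List.mem_singleton] at ha
    subst ha
    exact ⟨[], ∅, subset_rfl, ⟨by simp, .nil⟩, (multVec_nil c).symm⟩
  · intro W hW _ _
    rw [Finset.subset_empty] at hW
    subst hW
    exact ⟨(none, 0), by simp, [], ⟨by simp, .nil⟩, (multVec_nil c).symm⟩

/-- Linking entries corresponds to joining packings. -/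
theorem linkEntries_spec {B B' W W' : Finset V} {r : Option V} {v : V} (h : Linked G B r B' v)
    (hW : W ⊆ B) (hW' : W' ⊆ B') {a b : Entry c} {L L' : List ConsTree}
    (h₁ : RPack G c r (a.1.map shape) L W) (ha : a.2 = multVec c L)
    (h₂ : RPack G c (some v) (b.1.map shape) L' W') (hb : b.2 = multVec c L') {x : Entry c}
    (hx : linkEntries a b = some x) :
    ∃ M, RPack G c r (x.1.map shape) M (W ∪ W') ∧ x.2 = multVec c M := by
  obtain ⟨s, u⟩ := a
  obtain ⟨t, w⟩ := b
  dsimp only at ha hb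
  subst ha hb
  cases t with
  | none =>
    have hx' : x = (s, multVec c L + multVec c L' + 0) := by
      cases s <;> simpa [linkEntries, linkStates, eq_comm] using hx
    subst hx'
    exact ⟨L ++ L', h₁.join_none h hW hW' h₂, by rw [multVec_append, add_zero]⟩
  | some j =>
    cases s with
    | none =>
      have hx' : x = (none, multVec c L + multVec c L' + multVec c [shape j]) := by
        simpa [linkEntries, linkStates, eq_comm] using hx
      subst hx'
      refine ⟨L ++ shape j :: L', h₁.join_close h hW hW' h₂, ?_⟩
      rw [multVec_append, show shape j :: L' = [shape j] ++ L' from rfl, multVec_append, add_assoc,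
        add_comm (multVec c L')]
    | some i =>
      by_cases hc : shapeSize (.cons (shape j) (shape i)) ≤ c
      · have hx' : x = (some (shapeEquivFin c ⟨.cons (shape j) (shape i), hc⟩),
            multVec c L + multVec c L' + 0) := by
          simpa [linkEntries, linkStates, hc, eq_comm] using hx
        subst hx'
        refine ⟨L ++ L', ?_, by rw [multVec_append, add_zero]⟩
        rw [Option.map_some, shape_shapeEquivFin]
        exact h₁.join_graft h hW hW' hc h₂
      · simp [linkEntries, linkStates, hc] at hx

/-- Linking fails only if the grafted tree is too large. That tree is induced inside `W ∪ W'`, where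
large trees are excluded. -/
theorem linkEntries_isSome {B B' W W' : Finset V} {r : Option V} {v : V} (h : Linked G B r B' v)
    (hW : W ⊆ B) (hW' : W' ⊆ B') (hbd : BoundedTrees G c (W ∪ W')) {a b : Entry c}
    {L L' : List ConsTree} (h₁ : RPack G c r (a.1.map shape) L W)
    (h₂ : RPack G c (some v) (b.1.map shape) L' W') : ∃ x, linkEntries a b = some x := by
  obtain ⟨s, u⟩ := a
  obtain ⟨t, w⟩ := b
  cases t with
  | none => cases s <;> exact ⟨_, rfl⟩
  | some j =>
    cases s with
    | none => exact ⟨_, rfl⟩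
    | some i =>
      have hc : shapeSize (.cons (shape j) (shape i)) ≤ c := by
        obtain ⟨-, u, A, W₁, hr, rfl, -, hA, -⟩ := h₁
        obtain ⟨-, v', A', W₂, hv, rfl, -, hA', -⟩ := h₂
        obtain rfl : v = v' := by simpa using hv
        refine hbd _ _ _ (h.graft hr (Finset.subset_union_left.trans hW)
          (Finset.subset_union_left.trans hW') hA hA') ?_
        exact Finset.union_subset_union Finset.subset_union_left Finset.subset_union_left
      refine ⟨(some (shapeEquivFin c ⟨.cons (shape j) (shape i), hc⟩), u + w + 0), ?_⟩
      simp [linkEntries, linkStates, hc]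

theorem tableSpec_merge (B : Finset V) (r : Option V) (T : List (Entry c)) (B' : Finset V) (v : V)
    (T' : List (Entry c)) (h : Linked G B r B' v) (hT : TableSpec G c n B r T)
    (hT' : TableSpec G c n B' (some v) T') :
    TableSpec G c n (B ∪ B') r (mergeTables c n T T') := by
  constructor
  · intro x hx
    obtain ⟨-, a, ha, b, hb, hx⟩ := mem_mergeTables.1 hx
    obtain ⟨L, W, hW, h₁, e₁⟩ := hT.1 a ha
    obtain ⟨L', W', hW', h₂, e₂⟩ := hT'.1 b hb
    obtain ⟨M, hM, e⟩ := linkEntries_spec h hW hW' h₁ e₁ h₂ e₂ hx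
    exact ⟨M, W ∪ W', Finset.union_subset_union hW hW', hM, e⟩
  · intro W hW hbd hcard
    -- A set in the joint bag is looked up through its parts in the two tables; the bounds on trees
    -- and on the cardinality pass to subsets.
    have hsplit : W ∩ B ∪ W ∩ B' = W := by
      rw [← Finset.inter_union_distrib_left, Finset.inter_eq_left]
      exact hW
    have hsub : ∀ X : Finset V, BoundedTrees G c (W ∩ X) ∧ (W ∩ X).card ≤ n := fun X =>
      ⟨fun x r A hA hX => hbd x r A hA (hX.trans Finset.inter_subset_left),
        (Finset.card_le_card Finset.inter_subset_left).trans hcard⟩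
    obtain ⟨a, ha, L, h₁, e₁⟩ := hT.2 (W ∩ B) Finset.inter_subset_right (hsub B).1 (hsub B).2
    obtain ⟨b, hb, L', h₂, e₂⟩ := hT'.2 (W ∩ B') Finset.inter_subset_right (hsub B').1 (hsub B').2
    obtain ⟨x, hx⟩ := linkEntries_isSome h Finset.inter_subset_right Finset.inter_subset_right
      (by rwa [hsplit]) h₁ h₂
    obtain ⟨M, hM, e⟩ := linkEntries_spec h Finset.inter_subset_right Finset.inter_subset_right
      h₁ e₁ h₂ e₂ hx
    rw [hsplit] at hM
    refine ⟨x, mem_mergeTables.2 ⟨fun q => ?_, a, ha, b, hb, hx⟩, M, hM, e⟩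
    -- Truncating the multiplicities at `n` loses nothing, because a packing has at most as many
    -- trees as vertices.
    rw [e]
    refine (multVec_le c M q).trans (le_trans ?_ (hM.pack.length_le.trans hcard))
    simp

end dp

/-! ### Feasible multiplicities in a forest given by its adjacency matrix -/

/-- Lookup in an adjacency matrix. -/
def matAdj (M : List (List Bool)) (i j : ℕ) : Bool := (M.getD i []).getD j false

/-- The result of the dynamic program. -/
noncomputable def feasible (c : ℕ) (M : List (List Bool)) : List (Fin (numClasses c) → ℕ) :=
  ((elimStep (matAdj M) (mergeTables c M.length))^[M.length]
    ((List.range M.length).map fun v => (v, initTable c), [(none, 0)])).2.map Prod.snd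

open Classical in
/-- The adjacency matrix of a graph. -/
noncomputable def adjMat (F : FinGraph) : List (List Bool) :=
  List.ofFn fun i : Fin F.order => List.ofFn fun j : Fin F.order => decide (F.graph.Adj i j)

/-- The graph on the natural numbers with the same edges. -/
def natGraph (F : FinGraph) : SimpleGraph ℕ := F.graph.map Fin.valEmbedding

theorem natGraph_adj {F : FinGraph} {i j : ℕ} : (natGraph F).Adj i j ↔
    ∃ (hi : i < F.order) (hj : j < F.order), F.graph.Adj ⟨i, hi⟩ ⟨j, hj⟩ := by
  rw [natGraph, SimpleGraph.map_adj]
  constructor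
  · rintro ⟨a, b, h, rfl, rfl⟩
    exact ⟨a.2, b.2, h⟩
  · rintro ⟨hi, hj, h⟩
    exact ⟨_, _, h, rfl, rfl⟩

theorem length_adjMat (F : FinGraph) : (adjMat F).length = F.order := by simp [adjMat]

theorem matAdj_adjMat (F : FinGraph) (i j : ℕ) :
    matAdj (adjMat F) i j = true ↔ (natGraph F).Adj i j := by
  classical
  rw [natGraph_adj, matAdj, adjMat, List.getD_eq_getElem?_getD, List.getD_eq_getElem?_getD,
    List.getElem?_ofFn]
  by_cases hi : i < F.order
  · rw [dif_pos hi, Option.getD_some, List.getElem?_ofFn]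
    by_cases hj : j < F.order
    · simp [hi, hj]
    · simp [hj]
  · simp [hi]

theorem degenerate_natGraph {F : FinGraph} (hF : F.graph.IsAcyclic) :
    Degenerate (natGraph F) (List.range F.order).toFinset := by
  intro S hS hne
  have hlt : ∀ s ∈ S, s < F.order := fun s hs => by simpa using hS hs
  obtain ⟨v, hv, h⟩ := degenerate_of_isAcyclic hF Finset.univ
    (Finset.univ.filter fun i : Fin F.order => i.val ∈ S) (Finset.subset_univ _) (by
      obtain ⟨s, hs⟩ := hne
      exact ⟨⟨s, hlt s hs⟩, by simpa using hs⟩)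
  refine ⟨v, by simpa using hv, fun a ha b hb h1 h2 => ?_⟩
  obtain ⟨_, ha', h1⟩ := natGraph_adj.1 h1
  obtain ⟨_, hb', h2⟩ := natGraph_adj.1 h2
  have := h ⟨a, ha'⟩ (by simpa using ha) ⟨b, hb'⟩ (by simpa using hb) h1 h2
  simpa using this

theorem tableSpec_elim {c : ℕ} (hc : 1 ≤ c) {F : FinGraph} (hF : F.graph.IsAcyclic) :
    TableSpec (natGraph F) c F.order (List.range F.order).toFinset none
      ((elimStep (matAdj (adjMat F)) (mergeTables c F.order))^[F.order]
        ((List.range F.order).map fun v => (v, initTable c), [(none, 0)])).2 :=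
  elim_correct (Φ := TableSpec (natGraph F) c F.order) (matAdj_adjMat F)
    (init := fun _ => initTable c) (fun v => tableSpec_init hc v) tableSpec_empty tableSpec_merge
    List.nodup_range (degenerate_natGraph hF) (by simp)

theorem RPack.of_root_none {V : Type} [DecidableEq V] {G : SimpleGraph V} {c : ℕ}
    {st : Option ConsTree} {L : List ConsTree} {W : Finset V} (h : RPack G c none st L W) :
    Pack G c L W := by
  cases st with
  | none => exact h.2
  | some x => obtain ⟨-, v, _, _, hv, -⟩ := h; cases hv

theorem exists_pack_of_mem_feasible {c : ℕ} (hc : 1 ≤ c) {F : FinGraph} (hF : F.graph.IsAcyclic)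
    {d : Fin (numClasses c) → ℕ} (hd : d ∈ feasible c (adjMat F)) :
    ∃ (L : List ConsTree) (W : Finset (Fin F.order)), Pack F.graph c L W ∧ d = multVec c L := by
  rw [feasible, length_adjMat] at hd
  obtain ⟨a, ha, rfl⟩ := List.mem_map.1 hd
  obtain ⟨L, W, hW, h, e⟩ := (tableSpec_elim hc hF).1 a ha
  have hP := h.of_root_none
  -- The map back from `ℕ` to `Fin F.order` needs the vertex `0` as a default, so the empty graph is
  -- treated separately.
  rcases Nat.eq_zero_or_pos F.order with h0 | h0
  · rw [h0] at hW
    obtain rfl : W = ∅ := by simpa using hW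
    have := hP.length_le
    rw [Finset.card_empty, Nat.le_zero, List.length_eq_zero_iff] at this
    subst this
    exact ⟨[], ∅, .nil, e⟩
  · let f : ℕ → Fin F.order := fun i => if hi : i < F.order then ⟨i, hi⟩ else ⟨0, h0⟩
    have hlt : ∀ i ∈ W, i < F.order := fun i hi => by simpa using hW hi
    refine ⟨L, W.image f, hP.map ⟨?_, ?_⟩, e⟩
    · intro i hi j hj hij
      simpa [f, hlt i hi, hlt j hj] using hij
    · intro i hi j hj
      rw [natGraph_adj]
      simp [f, hlt i hi, hlt j hj]

theorem multVec_mem_feasible {c : ℕ} (hc : 1 ≤ c) {F : FinGraph} (hF : F.graph.IsAcyclic)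
    {L : List ConsTree} {W : Finset (Fin F.order)} (h : Pack F.graph c L W) :
    multVec c L ∈ feasible c (adjMat F) := by
  have hP : Pack (natGraph F) c L (W.image Fin.val) :=
    h.map ⟨Fin.val_injective.injOn, fun i _ j _ => by rw [natGraph_adj]; simp⟩
  obtain ⟨a, ha, L', h', e⟩ := (tableSpec_elim hc hF).2 (W.image Fin.val) (by
      intro i hi
      obtain ⟨j, -, rfl⟩ := Finset.mem_image.1 hi
      simp) (fun x r A hA hAW => hP.size_le_of_subset hA hAW)
      (Finset.card_image_le.trans (by simpa using Finset.card_le_univ W))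
  -- The table provides only some packing `L'` of the same vertex set, but the multiplicities do not
  -- depend on the packing.
  rw [feasible, length_adjMat, hP.multVec_eq h'.of_root_none, ← e]
  exact List.mem_map_of_mem ha


/-! ### The dynamic program runs in polynomial time -/

section polytime

variable {α : Type} [TreeCode α]

theorem PolyTime.state_eq {m : ℕ} {s t : α → Option (Fin m)} (hs : PolyTime s) (ht : PolyTime t) :
    PolyTime (fun a => decide (s a = t a)) :=
  ((FinCase.prod (FinCase.option (finCase_fin m)) (FinCase.option (finCase_fin m))).polyTime
    fun p => decide (p.1 = p.2)).comp (hs.pair ht)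

theorem PolyTime.entry_eq {c : ℕ} {x y : α → Entry c} (hx : PolyTime x) (hy : PolyTime y) :
    PolyTime (fun a => decide (x a = y a)) :=
  ((PolyTime.state_eq (PolyTime.fst.comp hx) (PolyTime.fst.comp hy)).and
    (PolyTime.vec_eq (PolyTime.snd.comp hx) (PolyTime.snd.comp hy))).of_eq fun a => by
      rw [Bool.eq_iff_iff]; simp [Prod.ext_iff]

/-- The states range over a finite set and are linked by a hardwired table; only the vectors grow
with the input. -/
theorem PolyTime.linkEntries {c : ℕ} {x y : α → Entry c} (hx : PolyTime x) (hy : PolyTime y) :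
    PolyTime (fun a => linkEntries (x a) (y a)) := by
  have h : PolyTime fun p : Option (Fin (numShapes c)) × Option (Fin (numShapes c)) =>
      linkStates p.1 p.2 :=
    (FinCase.prod (FinCase.option (finCase_fin _)) (FinCase.option (finCase_fin _))).polyTime _
  exact PolyTime.option_map (f := fun a (r : Entry c) => (r.1, (x a).2 + (y a).2 + r.2))
    (h.comp ((PolyTime.fst.comp hx).pair (PolyTime.fst.comp hy)))
    ((PolyTime.fst.comp .snd).pair ((((PolyTime.snd.comp hx).comp .fst).vec_add
      ((PolyTime.snd.comp hy).comp .fst)).vec_add (PolyTime.snd.comp .snd)))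

theorem PolyTime.allEntries (c : ℕ) {n : α → ℕ} (hn : PolyTime n) :
    PolyTime (fun a => allEntries c (n a)) :=
  PolyTime.flatMap (l := fun _ => none :: (List.finRange (numShapes c)).map Option.some)
    (f := fun a s => (MaxSubforest.vecsUpTo (numClasses c) (n a)).map fun v => (s, v))
    (.const _) (PolyTime.map (f := fun (p : α × Option (Fin (numShapes c))) v => (p.2, v))
      (PolyTime.vecsUpTo _ (hn.comp .fst)) ((PolyTime.snd.comp .fst).pair .snd))

theorem PolyTime.mergeTables (c : ℕ) {n : α → ℕ} {T T' : α → List (Entry c)} (hn : PolyTime n)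
    (hT : PolyTime T) (hT' : PolyTime T') : PolyTime (fun a => mergeTables c (n a) (T a) (T' a)) := by
  refine PolyTime.filter (f := fun a x => (T a).any fun u => (T' a).any fun v =>
    decide (MaxSubforest.linkEntries u v = Option.some x)) (PolyTime.allEntries c hn) ?_
  refine PolyTime.any (f := fun (p : α × Entry c) u => (T' p.1).any fun v =>
    decide (MaxSubforest.linkEntries u v = Option.some p.2)) (hT.comp .fst) ?_
  refine PolyTime.any (f := fun (p : (α × Entry c) × Entry c) v =>
    decide (MaxSubforest.linkEntries p.2 v = Option.some p.1.2)) (hT'.comp (PolyTime.fst.comp .fst)) ?_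
  refine (PolyTime.option_elim (g := fun _ => false)
    (f := fun (p : ((α × Entry c) × Entry c) × Entry c) y => decide (y = p.1.1.2))
    (PolyTime.linkEntries (PolyTime.snd.comp .fst) .snd) (.const false)
    (PolyTime.entry_eq .snd (PolyTime.snd.comp (PolyTime.fst.comp (PolyTime.fst.comp .fst))))).of_eq
    fun p => ?_
  cases MaxSubforest.linkEntries p.1.2 p.2 <;> simp

theorem PolyTime.matAdj {M : α → List (List Bool)} {i j : α → ℕ} (hM : PolyTime M)
    (hi : PolyTime i) (hj : PolyTime j) : PolyTime (fun a => matAdj (M a) (i a) (j a)) :=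
  (hM.getD hi (.const [])).getD hj (.const false)

variable {τ : Type} [TreeCode τ]

theorem PolyTime.elimVertex {adj : α → ℕ → ℕ → Bool} {merge : α → τ → τ → τ}
    (hadj : PolyTime fun p : α × ℕ × ℕ => adj p.1 p.2.1 p.2.2)
    (hmerge : PolyTime fun p : α × τ × τ => merge p.1 p.2.1 p.2.2) :
    PolyTime (fun p : (α × List (ℕ × τ) × τ) × (ℕ × τ) =>
      elimVertex (adj p.1.1) (merge p.1.1) p.1.2 p.2) := by
  have hctx : PolyTime fun p : (α × List (ℕ × τ) × τ) × (ℕ × τ) => p.1.1 := .comp .fst .fst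
  have hrest : PolyTime fun p : (α × List (ℕ × τ) × τ) × (ℕ × τ) =>
      p.1.2.1.filter fun q => !decide (q.1 = p.2.1) :=
    PolyTime.filter
      (f := fun (p : (α × List (ℕ × τ) × τ) × (ℕ × τ)) q => !decide (q.1 = p.2.1))
      (PolyTime.fst.comp (PolyTime.snd.comp .fst))
      (PolyTime.not ((PolyTime.fst.comp .snd).nat_eq (PolyTime.fst.comp (PolyTime.snd.comp .fst))))
  have hnb : PolyTime fun q : ((α × List (ℕ × τ) × τ) × (ℕ × τ)) × (ℕ × τ) =>
      adj q.1.1.1 q.1.2.1 q.2.1 :=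
    hadj.comp (.pair (hctx.comp .fst) (.pair (PolyTime.fst.comp (PolyTime.snd.comp .fst))
      (PolyTime.fst.comp .snd)))
  refine PolyTime.ite (hrest.any (f := fun p q => adj p.1.1 p.2.1 q.1) hnb) (.pair ?_ ?_)
    (.pair hrest ?_)
  · refine hrest.map (f := fun p q =>
      if adj p.1.1 p.2.1 q.1 then (q.1, merge p.1.1 q.2 p.2.2) else q) (.ite hnb (.pair ?_ ?_) .snd)
    · exact .comp .fst .snd
    · exact hmerge.comp (.pair (hctx.comp .fst) (.pair (.comp .snd .snd)
        (PolyTime.snd.comp (PolyTime.snd.comp .fst))))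
  · exact PolyTime.snd.comp (PolyTime.snd.comp .fst)
  · exact hmerge.comp (.pair hctx (.pair (PolyTime.snd.comp (PolyTime.snd.comp .fst))
      (.comp .snd .snd)))

theorem PolyTime.elimStep {adj : α → ℕ → ℕ → Bool} {merge : α → τ → τ → τ}
    (hadj : PolyTime fun p : α × ℕ × ℕ => adj p.1 p.2.1 p.2.2)
    (hmerge : PolyTime fun p : α × τ × τ => merge p.1 p.2.1 p.2.2) :
    PolyTime (fun p : α × List (ℕ × τ) × τ => elimStep (adj p.1) (merge p.1) p.2) := by
  refine PolyTime.option_elim (f := fun p q =>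
    MaxSubforest.elimVertex (adj p.1) (merge p.1) p.2 q) ?_ .snd (PolyTime.elimVertex hadj hmerge)
  refine PolyTime.find? (f := fun (p : α × List (ℕ × τ) × τ) r =>
    (p.2.1.filter fun q => adj p.1 r.1 q.1).tail.isEmpty) (.comp .fst .snd) ?_
  refine PolyTime.isEmpty (PolyTime.tail (PolyTime.filter
    (f := fun (p : (α × List (ℕ × τ) × τ) × (ℕ × τ)) q => adj p.1.1 p.2.1 q.1)
    (PolyTime.fst.comp (PolyTime.snd.comp .fst)) ?_))
  exact hadj.comp (.pair (PolyTime.fst.comp (PolyTime.fst.comp .fst))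
    (.pair (PolyTime.fst.comp (PolyTime.snd.comp .fst)) (.comp .fst .snd)))

/-- A bound on the size of the intermediate states of the elimination. -/
theorem tsize_elim_le {adj : ℕ → ℕ → Bool} {merge : τ → τ → τ} {n b : ℕ}
    (hb : ∀ t t', tsize (merge t t') ≤ b) {s : List (ℕ × τ) × τ} (h₁ : s.1.length ≤ n)
    (h₂ : ∀ p ∈ s.1, p.1 ≤ n ∧ tsize p.2 ≤ b) (h₃ : tsize s.2 ≤ b) (i : ℕ) :
    tsize ((elimStep adj merge)^[i] s) ≤ n * (2 * n + b + 3) + b + 2 := by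
  have key : ((elimStep adj merge)^[i] s).1.length ≤ n ∧
      (∀ p ∈ ((elimStep adj merge)^[i] s).1, p.1 ≤ n ∧ tsize p.2 ≤ b) ∧
      tsize ((elimStep adj merge)^[i] s).2 ≤ b := by
    induction i with
    | zero => exact ⟨h₁, h₂, h₃⟩
    | succ i ih =>
      rw [Function.iterate_succ_apply']
      generalize (elimStep adj merge)^[i] s = s at ih
      obtain ⟨ih₁, ih₂, ih₃⟩ := ih
      unfold elimStep
      cases s.1.find? _ with
      | none => exact ⟨ih₁, ih₂, ih₃⟩
      | some p =>
        have hlen := (List.length_filter_le (fun q => !decide (q.1 = p.1)) s.1).trans ih₁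
        have hmem : ∀ q ∈ s.1.filter fun q => !decide (q.1 = p.1), q.1 ≤ n ∧ tsize q.2 ≤ b :=
          fun q hq => ih₂ q (List.mem_filter.1 hq).1
        simp only [Option.elim_some]
        unfold elimVertex
        split_ifs
        · refine ⟨by simpa using hlen, ?_, ih₃⟩
          intro q hq
          obtain ⟨r, hr, rfl⟩ := List.mem_map.1 hq
          obtain ⟨hr₁, hr₂⟩ := hmem r hr
          split_ifs
          · exact ⟨hr₁, hb _ _⟩
          · exact ⟨hr₁, hr₂⟩
        · exact ⟨hlen, hmem, hb _ _⟩
  obtain ⟨k₁, k₂, k₃⟩ := key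
  generalize (elimStep adj merge)^[i] s = s at k₁ k₂ k₃
  obtain ⟨R, t⟩ := s
  rw [tsize_pair]
  dsimp only at k₁ k₂ k₃
  have := tsize_list_le (l := R) (B := 2 * n + b + 2) (fun p hp => by
    obtain ⟨h1, h2⟩ := k₂ p hp
    obtain ⟨v, t⟩ := p
    rw [tsize_pair, tsize_nat]
    dsimp only at h1 h2
    omega)
  have h2 := Nat.mul_le_mul_right (2 * n + b + 3) k₁
  rw [show 2 * n + b + 2 + 1 = 2 * n + b + 3 from rfl] at this
  omega

end polytime

theorem polyTime_feasible (c : ℕ) : PolyTime (feasible c) := by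
  have hlen : PolyTime fun M : List (List Bool) => M.length := .length .id
  have hmerge : PolyTime fun p : List (List Bool) × List (Entry c) × List (Entry c) =>
      mergeTables c p.1.length p.2.1 p.2.2 :=
    PolyTime.mergeTables c (.length .fst) (.comp .fst .snd) (.comp .snd .snd)
  have hadj : PolyTime fun p : List (List Bool) × ℕ × ℕ => matAdj p.1 p.2.1 p.2.2 :=
    PolyTime.matAdj .fst (.comp .fst .snd) (.comp .snd .snd)
  have hstep := PolyTime.elimStep (adj := matAdj)
    (merge := fun M => mergeTables c M.length) hadj hmerge
  have hinit : PolyTime fun M : List (List Bool) =>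
      ((List.range M.length).map fun v => (v, initTable c),
        ([(none, 0)] : List (Entry c))) :=
    .pair (hlen.range.map (f := fun _ v => (v, initTable c)) (.pair .snd (.const _))) (.const _)
  have hb : PolyBdd fun M : List (List Bool) => tsize (allEntries c M.length) +
      tsize (initTable c) + tsize ([(none, 0)] : List (Entry c)) :=
    ((PolyTime.allEntries c hlen).size.add (.const _)).add (.const _)
  have hn : PolyBdd fun M : List (List Bool) => M.length :=
    PolyBdd.size.mono fun M => length_le_tsize M
  refine PolyTime.map (f := fun _ (x : Entry c) => x.2) (.comp .snd (PolyTime.iterate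
    (h := fun M => elimStep (matAdj M) (mergeTables c M.length)) hlen hinit hstep
    (((hn.mul ((((PolyBdd.const 2).mul hn).add hb).add (.const 3))).add hb).add (.const 2))
    fun M i _ => tsize_elim_le (fun t t' => ?_) ?_ ?_ ?_ i)) (.comp .snd .snd)
  -- Merging filters the fixed list of all entries, so a merged table is of polynomial size whatever
  -- tables were merged; in particular, sizes do not accumulate over the elimination.
  · have := tsize_le_of_sublist (List.filter_sublist (l := allEntries c M.length)
      (p := fun x => t.any fun a => t'.any fun b => decide (linkEntries a b = some x)))
    unfold mergeTables
    omega
  · simp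
  · intro p hp
    obtain ⟨v, hv, rfl⟩ := List.mem_map.1 hp
    have := List.mem_range.1 hv
    dsimp only
    omega
  · dsimp only
    omega


/-! ### The forest with given multiplicities -/

section realization

variable {c : ℕ}

/-- The vertices of a tree in a given class. -/
def RealVert (q : Fin (numClasses c)) : Type := (exists_isTr (rep q).1).choose

noncomputable instance (q : Fin (numClasses c)) : DecidableEq (RealVert q) :=
  (exists_isTr (rep q).1).choose_spec.choose

noncomputable instance (q : Fin (numClasses c)) : Fintype (RealVert q) :=
  (exists_isTr (rep q).1).choose_spec.choose_spec.choose

/-- A tree in a given class. -/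
noncomputable def realGraph (q : Fin (numClasses c)) : SimpleGraph (RealVert q) :=
  (exists_isTr (rep q).1).choose_spec.choose_spec.choose_spec.choose

theorem isTr_realGraph (q : Fin (numClasses c)) :
    ∃ r, IsTr (realGraph q) (rep q).1 r Finset.univ :=
  (exists_isTr (rep q).1).choose_spec.choose_spec.choose_spec.choose_spec

variable (c) in
/-- The vertices of all the chosen trees. -/
abbrev Cell : Type := Σ q : Fin (numClasses c), RealVert q

/-- Adjacency in the disjoint union of the chosen trees. -/
inductive CellAdj : Cell c → Cell c → Prop
  | mk (q : Fin (numClasses c)) {a b : RealVert q} (h : (realGraph q).Adj a b) :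
      CellAdj ⟨q, a⟩ ⟨q, b⟩

theorem cellAdj_iff {q : Fin (numClasses c)} {a b : RealVert q} :
    CellAdj ⟨q, a⟩ ⟨q, b⟩ ↔ (realGraph q).Adj a b := by
  constructor
  · rintro ⟨_, h⟩
    exact h
  · exact CellAdj.mk q

theorem CellAdj.fst_eq {x y : Cell c} (h : CellAdj x y) : x.1 = y.1 := by cases h; rfl

variable (c) in
/-- The number of vertices of all the chosen trees. -/
noncomputable def numCells : ℕ := Nat.card (Cell c)

variable (c) in
/-- A numbering of the vertices of the chosen trees. -/
noncomputable def cellEquivFin : Cell c ≃ Fin (numCells c) := Finite.equivFin _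

/-- The tree that contains a vertex. -/
noncomputable def cellClass (e : Fin (numCells c)) : Fin (numClasses c) :=
  ((cellEquivFin c).symm e).1

variable (c) in
/-- The disjoint union of infinitely many copies of each of the chosen trees. -/
def blockGraph : SimpleGraph (ℕ × Fin (numCells c)) where
  Adj x y := x.1 = y.1 ∧ CellAdj ((cellEquivFin c).symm x.2) ((cellEquivFin c).symm y.2)
  symm := ⟨fun _ _ h => ⟨h.1.symm, by
    obtain ⟨-, h⟩ := h
    revert h
    generalize (cellEquivFin c).symm _ = x
    generalize (cellEquivFin c).symm _ = y
    rintro ⟨q, h⟩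
    exact .mk q h.symm⟩⟩
  loopless := ⟨fun _ h => by
    obtain ⟨-, h⟩ := h
    revert h
    generalize (cellEquivFin c).symm _ = x
    intro h
    obtain ⟨q, a⟩ := x
    exact (cellAdj_iff.1 h).ne rfl⟩

/-- The vertices of one of the copies. -/
noncomputable def block (p : ℕ × Fin (numClasses c)) : Finset (ℕ × Fin (numCells c)) :=
  Finset.univ.image fun a : RealVert p.2 => (p.1, cellEquivFin c ⟨p.2, a⟩)

theorem mem_block {p : ℕ × Fin (numClasses c)} {x : ℕ × Fin (numCells c)} :
    x ∈ block p ↔ x.1 = p.1 ∧ cellClass x.2 = p.2 := by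
  obtain ⟨i, q⟩ := p
  obtain ⟨j, e⟩ := x
  simp only [block, Finset.mem_image, Finset.mem_univ, true_and, Prod.mk.injEq, cellClass]
  constructor
  · rintro ⟨a, rfl, rfl⟩
    simp
  · rintro ⟨rfl, rfl⟩
    exact ⟨((cellEquivFin c).symm e).2, rfl, by simp⟩

theorem isTr_block (p : ℕ × Fin (numClasses c)) :
    ∃ r, IsTr (blockGraph c) (rep p.2).1 r (block p) := by
  obtain ⟨r, hr⟩ := isTr_realGraph p.2
  refine ⟨_, hr.map (f := fun a => (p.1, cellEquivFin c ⟨p.2, a⟩)) ⟨?_, ?_⟩⟩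
  · intro a _ b _ h
    simpa using h
  · intro a _ b _
    simp [blockGraph, cellAdj_iff]

/-- Distinct blocks differ in the copy index or in the class, and adjacent vertices agree in both.
-/
theorem pack_blocks (l : List (ℕ × Fin (numClasses c))) (hl : l.Nodup) :
    Pack (blockGraph c) c (l.map fun p => (rep p.2).1) (l.toFinset.biUnion block) := by
  induction l with
  | nil => exact .nil
  | cons p l ih =>
    rw [List.nodup_cons] at hl
    obtain ⟨r, hr⟩ := isTr_block p
    rw [List.toFinset_cons, Finset.biUnion_insert]
    refine .cons (rep p.2).2 hr ?_ (ih hl.2)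
    intro x hx y hy
    obtain ⟨p', hp', hy⟩ := Finset.mem_biUnion.1 hy
    rw [mem_block] at hx hy
    have hne : p ≠ p' := by
      rintro rfl
      exact hl.1 (by simpa using hp')
    constructor
    · rintro rfl
      exact hne (Prod.ext (hx.1.symm.trans hy.1) (hx.2.symm.trans hy.2))
    · rintro ⟨h1, h2⟩
      refine hne (Prod.ext (hx.1.symm.trans (h1.trans hy.1)) (hx.2.symm.trans ?_))
      rw [← hy.2]
      exact h2.fst_eq

/-- The copies of trees that are used for given multiplicities. -/
noncomputable def blocksOf (d : Fin (numClasses c) → ℕ) : List (ℕ × Fin (numClasses c)) :=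
  (List.finRange _).flatMap fun q => (List.range (d q)).map fun i => (i, q)

/-- The vertices of the forest with given multiplicities. -/
noncomputable def cellsOf (d : Fin (numClasses c) → ℕ) : List (ℕ × Fin (numCells c)) :=
  (List.finRange _).flatMap fun e => (List.range (d (cellClass e))).map fun i => (i, e)

theorem nodup_flatMap_range {m : ℕ} (f : Fin m → ℕ) :
    ((List.finRange m).flatMap fun e => (List.range (f e)).map fun i => (i, e)).Nodup := by
  rw [List.nodup_flatMap]
  refine ⟨fun e _ => List.nodup_range.map fun i j h => by simpa using h, ?_⟩
  refine (List.nodup_finRange m).imp fun {a b} hab => ?_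
  intro x hx hy
  simp only [List.mem_map] at hx hy
  obtain ⟨i, -, rfl⟩ := hx
  obtain ⟨j, -, h⟩ := hy
  exact hab (Prod.ext_iff.1 h).2.symm

theorem mem_cellsOf {d : Fin (numClasses c) → ℕ} {x : ℕ × Fin (numCells c)} :
    x ∈ cellsOf d ↔ x.1 < d (cellClass x.2) := by
  obtain ⟨i, e⟩ := x
  simp [cellsOf]

theorem pack_cellsOf (d : Fin (numClasses c) → ℕ) :
    ∃ L, Pack (blockGraph c) c L (cellsOf d).toFinset ∧ multVec c L = d := by
  refine ⟨(blocksOf d).map fun p => (rep p.2).1, ?_, ?_⟩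
  · convert pack_blocks (blocksOf d) (nodup_flatMap_range d) using 1
    ext x
    simp [mem_cellsOf, mem_block, blocksOf]
  · funext q
    have h : ((blocksOf d).map fun p => (rep p.2).1).map (classOf c) =
        (List.finRange _).flatMap fun q => List.replicate (d q) (some q) := by
      simp [blocksOf, List.map_flatMap, Function.comp_def, classOf_rep]
    rw [multVec, h, List.count_flatMap, ← Fin.sum_univ_def]
    simp [List.count_replicate]

/-- The forest with given multiplicities. -/
noncomputable def outGraph (d : Fin (numClasses c) → ℕ) : FinGraph where
  order := (cellsOf d).length
  graph := (blockGraph c).comap fun i => (cellsOf d)[i]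

open Classical in
/-- Adjacency of numbered vertices of the chosen trees. -/
noncomputable def cellBit (e e' : Fin (numCells c)) : Bool :=
  decide (CellAdj ((cellEquivFin c).symm e) ((cellEquivFin c).symm e'))

/-- Its adjacency matrix. -/
noncomputable def outMat (d : Fin (numClasses c) → ℕ) : List (List Bool) :=
  (cellsOf d).map fun x => (cellsOf d).map fun y => decide (x.1 = y.1) && cellBit x.2 y.2

theorem adjMat_outGraph (d : Fin (numClasses c) → ℕ) : adjMat (outGraph d) = outMat d := by
  classical
  rw [outMat, ← List.ofFn_getElem_eq_map, adjMat]
  congr 1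
  funext i
  rw [← List.ofFn_getElem_eq_map]
  congr 1
  funext j
  rw [Bool.eq_iff_iff, decide_eq_true_iff, Bool.and_eq_true, decide_eq_true_iff, cellBit,
    decide_eq_true_iff]
  rfl

/-- A packing with given multiplicities induces the forest with these multiplicities. -/
theorem Pack.outGraph {F : FinGraph} {L : List ConsTree} {W : Finset (Fin F.order)}
    (h : Pack F.graph c L W) : (outGraph (multVec c L)).graph.IsIndContained F.graph ∧
      (outGraph (multVec c L)).order = W.card := by
  obtain ⟨L', h', e⟩ := pack_cellsOf (multVec c L)
  obtain ⟨M, h₁, h₂⟩ := h'.exists_common h e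
  have hnd : (cellsOf (multVec c L)).Nodup := nodup_flatMap_range _
  constructor
  · refine SimpleGraph.IsIndContained.trans ?_ (h₁.isIndContained h₂)
    refine ⟨⟨⟨fun i => ⟨(cellsOf (multVec c L))[i], by simp⟩, fun i j hij => ?_⟩, Iff.rfl⟩⟩
    have := Subtype.ext_iff.1 hij
    exact Fin.ext (hnd.getElem_inj_iff.1 this)
  · rw [h₂.card, ← h₁.card, List.toFinset_card_of_nodup hnd]
    rfl

/-- The class of a cell is a constant of the program, so a case distinction on the cell reduces its
multiplicity to the access to a fixed coordinate. -/
theorem polyTime_cellsOf : PolyTime (cellsOf (c := c)) := by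
  have h : PolyTime fun p : (Fin (numClasses c) → ℕ) × Fin (numCells c) =>
      p.1 (cellClass p.2) :=
    (finCase_fin (numCells c)).comp (f := fun e (d : Fin (numClasses c) → ℕ) => d (cellClass e))
      (fun e => PolyTime.apply _) .snd .fst
  exact PolyTime.flatMap (l := fun _ => List.finRange (numCells c))
    (f := fun d e => (List.range (d (cellClass e))).map fun i => (i, e)) (.const _)
    (PolyTime.map (f := fun (p : (Fin (numClasses c) → ℕ) × Fin (numCells c)) i => (i, p.2))
      h.range (.pair .snd (.comp .snd .fst)))

theorem polyTime_outMat : PolyTime (outMat (c := c)) := by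
  have hbit : PolyTime fun p : Fin (numCells c) × Fin (numCells c) => cellBit p.1 p.2 :=
    (FinCase.prod (finCase_fin _) (finCase_fin _)).polyTime _
  refine PolyTime.map (f := fun d (x : ℕ × Fin (numCells c)) =>
    (cellsOf d).map fun y => decide (x.1 = y.1) &&
    cellBit x.2 y.2) polyTime_cellsOf ?_
  refine PolyTime.map (f := fun (p : (Fin (numClasses c) → ℕ) × ℕ × Fin (numCells c)) y =>
    decide (p.2.1 = y.1) && cellBit p.2.2 y.2) (polyTime_cellsOf.comp .fst)
    (.and (.nat_eq ?_ (.comp .fst .snd)) (hbit.comp (.pair ?_ (.comp .snd .snd))))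
  · exact PolyTime.fst.comp (PolyTime.snd.comp .fst)
  · exact PolyTime.snd.comp (PolyTime.snd.comp .fst)

/-! ### Choosing the best multiplicities -/

/-- An element of a list of multiplicities for which the forest is largest. -/
noncomputable def bestOf (S : List (Fin (numClasses c) → ℕ)) : Fin (numClasses c) → ℕ :=
  S.foldl (fun b d => if decide ((cellsOf b).length ≤ (cellsOf d).length) then d else b) 0

/-- The start value counts as a candidate. `bestOf` starts with `0`, the empty forest, so the list
need not be known to be nonempty. -/
theorem foldl_best_spec (S : List (Fin (numClasses c) → ℕ)) : ∀ b : Fin (numClasses c) → ℕ,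
    S.foldl (fun b d => if decide ((cellsOf b).length ≤ (cellsOf d).length) then d else b) b ∈
        b :: S ∧
      ∀ d ∈ b :: S, (cellsOf d).length ≤ (cellsOf (S.foldl (fun b d =>
        if decide ((cellsOf b).length ≤ (cellsOf d).length) then d else b) b)).length := by
  induction S with
  | nil => simp
  | cons d S ih =>
    intro b
    rw [List.foldl_cons]
    obtain ⟨h1, h2⟩ := ih (if decide ((cellsOf b).length ≤ (cellsOf d).length) then d else b)
    generalize List.foldl _ _ S = z at h1 h2 ⊢
    by_cases h : (cellsOf b).length ≤ (cellsOf d).length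
    · simp only [h, decide_true, if_true] at h1 h2
      refine ⟨List.mem_cons_of_mem _ h1, fun x hx => ?_⟩
      rcases List.mem_cons.1 hx with rfl | hx
      · exact h.trans (h2 d (by simp))
      · exact h2 x hx
    · simp only [h, decide_false, Bool.false_eq_true, if_false] at h1 h2
      refine ⟨?_, fun x hx => ?_⟩
      · rcases List.mem_cons.1 h1 with h1 | h1 <;> simp [h1]
      · rcases List.mem_cons.1 hx with rfl | hx
        · exact h2 x (by simp)
        · rcases List.mem_cons.1 hx with rfl | hx
          · exact (Nat.le_of_not_le h).trans (h2 b (by simp))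
          · exact h2 x (by simp [hx])

/-- The accumulator is always zero or an element of the list, which bounds its size. -/
theorem polyTime_bestOf : PolyTime (bestOf (c := c)) := by
  refine PolyTime.foldl (l := fun S => S) (g := fun _ => 0) (h := fun _ b d =>
    if decide ((cellsOf b).length ≤ (cellsOf d).length) then d else b) .id (.const 0)
    (.ite (.nat_le (.length (polyTime_cellsOf.comp (.comp .fst .snd)))
      (.length (polyTime_cellsOf.comp (.comp .snd .snd)))) (.comp .snd .snd) (.comp .fst .snd))
    (B := fun S => tsize S + tsize (0 : Fin (numClasses c) → ℕ)) (PolyBdd.size.add (.const _))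
    fun S l hl => ?_
  rcases List.mem_cons.1 (foldl_best_spec l 0).1 with h | h
  · rw [h]; omega
  · exact (tsize_le_of_mem (hl.subset h)).trans (Nat.le_add_right _ _)

end realization

/-! ### The algorithm -/

/-- The multiplicities in `S` that are feasible for a further forest. -/
noncomputable def restrict (c : ℕ) (S : List (Fin (numClasses c) → ℕ)) (M : List (List Bool)) :
    List (Fin (numClasses c) → ℕ) :=
  S.filter fun d => (feasible c M).any fun d' => decide (d = d')

theorem mem_restrict {c : ℕ} {S : List (Fin (numClasses c) → ℕ)} {M : List (List Bool)}
    {d : Fin (numClasses c) → ℕ} : d ∈ restrict c S M ↔ d ∈ S ∧ d ∈ feasible c M := by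
  simp [restrict]

theorem PolyTime.filter_mem {α : Type} [TreeCode α] {k : ℕ} {l m : α → List (Fin k → ℕ)}
    (hl : PolyTime l) (hm : PolyTime m) :
    PolyTime (fun a => (l a).filter fun d => (m a).any fun d' => decide (d = d')) := by
  have h : PolyTime fun p : α × (Fin k → ℕ) => (m p.1).any fun d' => decide (p.2 = d') :=
    (hm.comp .fst).any (f := fun p d' => decide (p.2 = d')) (.vec_eq (.comp .snd .fst) .snd)
  exact hl.filter (f := fun a d => (m a).any fun d' => decide (d = d')) h

theorem polyTime_restrict (c : ℕ) : PolyTime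
    fun q : Unit × List (Fin (numClasses c) → ℕ) × List (List Bool) => restrict c q.2.1 q.2.2 :=
  PolyTime.filter_mem (.comp .fst .snd) ((polyTime_feasible c).comp (.comp .snd .snd))

theorem mem_foldl_restrict {c : ℕ} {l : List (List (List Bool))} {d : Fin (numClasses c) → ℕ} :
    ∀ {S : List (Fin (numClasses c) → ℕ)},
      d ∈ l.foldl (restrict c) S ↔ d ∈ S ∧ ∀ M ∈ l, d ∈ feasible c M := by
  induction l with
  | nil => simp
  | cons M l ih =>
    intro S
    rw [List.foldl_cons, ih, mem_restrict]
    simp [and_assoc]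

/-- This keeps the accumulator of the outer loop within the size of the first table, independently
of the number of forests. -/
theorem foldl_restrict_sublist {c : ℕ} (l : List (List (List Bool))) :
    ∀ S : List (Fin (numClasses c) → ℕ), (l.foldl (restrict c) S).Sublist S := by
  induction l with
  | nil => exact fun S => .refl _
  | cons M l ih => exact fun S => (ih _).trans List.filter_sublist

/-- Multiplicities that are feasible for all forests and give a largest forest. -/
noncomputable def bestCommon (c : ℕ) (l : List (List (List Bool))) : Fin (numClasses c) → ℕ :=
  bestOf (l.foldl (restrict c) (feasible c (l.headD [])))

theorem tsize_adjMat_le {F : FinGraph} {n : ℕ} (hn : F.order ≤ n) :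
    tsize (adjMat F) ≤ n * (n * 4 + 2) + 1 := by
  classical
  refine (tsize_list_le (B := n * 4 + 1) fun r hr => ?_).trans ?_
  · obtain ⟨i, rfl⟩ := (List.mem_ofFn' _ _).1 hr
    refine (tsize_list_le (B := 3) fun b _ => tsize_bool_le b).trans ?_
    rw [List.length_ofFn]
    omega
  · rw [length_adjMat]
    exact Nat.add_le_add_right (Nat.mul_le_mul_right _ hn) 1

/-- The algorithm runs in time linear in the number of forests and polynomial in their order. -/
theorem exists_program (c : ℕ) : ∃ (P : WhileCmd) (g : ℕ → ℕ), PolyBdd g ∧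
    ∀ (l : List (List (List Bool))) (m : ℕ), l ≠ [] → (∀ M ∈ l, tsize M ≤ m) →
      ∃ t, P.OutputsIn (code l) (code (outMat (bestCommon c l))) t ∧ t ≤ l.length * g m := by
  -- The bounds are unpacked because a polynomial in the size of the whole input would not be linear
  -- in the number of forests.
  obtain ⟨⟨P₁, T₁, hP₁, C₁, p₁, hT₁⟩, D₁, q₁, hs₁⟩ := polyTime_feasible c
  obtain ⟨⟨P₂, T₂, hP₂, C₂, p₂, hT₂⟩, -⟩ := polyTime_restrict c
  obtain ⟨⟨P₃, T₃, hP₃, C₃, p₃, hT₃⟩, -⟩ := (polyTime_outMat (c := c)).comp polyTime_bestOf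
  have hhead : Computes (.assign 0 (.hd (.var 0))) (fun l : List (List (List Bool)) => l.headD [])
      (fun _ => 3) := .ofExpr _ fun l s h => by
    cases l <;> simp [WhileExpr.eval, h] <;> rfl
  have hid : Computes .skip (fun l : List (List (List Bool)) => l) (fun _ => 1) :=
    fun a s h => ⟨s, 1, .skip s, h, le_rfl⟩
  have hunit : Computes (.assign 0 .nil) (fun _ : List (List (List Bool)) => ()) (fun _ => 2) :=
    .ofExpr _ fun l s h => rfl
  -- This prepares context, start value and list for the loop. The list is passed on as a pointer,
  -- so the time involves the first matrix only.
  obtain ⟨A, hA⟩ : ∃ A, Computes A (fun l : List (List (List Bool)) =>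
      ((), feasible c (l.headD []), l)) (fun l => 22 + T₁ (l.headD [])) :=
    ⟨_, (hunit.pair ((hhead.comp hP₁).pair hid)).mono fun l => by omega⟩
  have hm : PolyBdd fun m : ℕ => m := PolyBdd.size.mono fun m => by rw [tsize_nat]; omega
  have hc := fun k => PolyBdd.const (α := ℕ) k
  have hS : PolyBdd fun m : ℕ => D₁ * m ^ q₁ := (hc D₁).mul (hm.pow q₁)
  refine ⟨.seq (.seq A (foldCmd P₂)) P₃, fun m => 100 + C₁ * m ^ p₁ +
    C₂ * (D₁ * m ^ q₁ + m + 3) ^ p₂ + C₃ * (D₁ * m ^ q₁) ^ p₃,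
    (((hc 100).add ((hc C₁).mul (hm.pow p₁))).add ((hc C₂).mul
      (((hS.add hm).add (hc 3)).pow p₂))).add ((hc C₃).mul (hS.pow p₃)), fun l m hl hlm => ?_⟩
  have hhd : tsize (l.headD []) ≤ m := by
    cases l with
    | nil => exact absurd rfl hl
    | cons M l => exact hlm M (by simp)
  have hfeas : tsize (feasible c (l.headD [])) ≤ D₁ * m ^ q₁ :=
    (hs₁ _).trans (Nat.mul_le_mul_left _ (Nat.pow_le_pow_left hhd _))
  have hsub : ∀ l' : List (List (List Bool)),
      tsize (l'.foldl (restrict c) (feasible c (l.headD []))) ≤ D₁ * m ^ q₁ := fun l' =>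
    (tsize_le_of_sublist (foldl_restrict_sublist l' _)).trans hfeas
  obtain ⟨s₁, t₁, r₁, e₁, b₁⟩ := hA l (WhileCmd.initStore (code l)) (by simp [WhileCmd.initStore])
  obtain ⟨s₂, t₂, r₂, e₂, b₂⟩ := foldCmd_runs (h := fun _ => restrict c) hP₂ () _ l
    (C₂ * (D₁ * m ^ q₁ + m + 3) ^ p₂) (fun l₁ M l₂ e => by
      refine (hT₂ _).trans (Nat.mul_le_mul_left _ (Nat.pow_le_pow_left ?_ _))
      have h1 := hsub l₁
      have h2 := hlm M (by simp [e])
      rw [tsize_pair, tsize_pair]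
      change 1 + _ + 1 ≤ _
      omega) s₁ e₁
  obtain ⟨s₃, t₃, r₃, e₃, b₃⟩ := hP₃ _ s₂ e₂
  refine ⟨_, ⟨s₃, .seq (.seq r₁ r₂) r₃, e₃⟩, ?_⟩
  have hb₁ : T₁ (l.headD []) ≤ C₁ * m ^ p₁ :=
    (hT₁ _).trans (Nat.mul_le_mul_left _ (Nat.pow_le_pow_left hhd _))
  have hb₃ := b₃.trans ((hT₃ _).trans (Nat.mul_le_mul_left C₃
    (Nat.pow_le_pow_left (hsub l) p₃)))
  have hlen : 1 ≤ l.length := List.length_pos_iff.2 hl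
  dsimp only at b₁ ⊢
  generalize C₁ * m ^ p₁ = A at *
  generalize C₂ * (D₁ * m ^ q₁ + m + 3) ^ p₂ = B at *
  generalize C₃ * (D₁ * m ^ q₁) ^ p₃ = D at *
  generalize l.length = k at *
  -- The costs that arise only once are charged to the `k ≥ 1` rounds.
  have h1 : 80 + A + D ≤ k * (80 + A + D) := Nat.le_mul_of_pos_left _ hlen
  have h2 : k * (100 + A + B + D) = k * (80 + A + D) + k * (B + 20) := by ring
  omega

/-! ### Correctness and approximation ratio -/

theorem encode_eq_code (F : FinGraph) : F.encode = code (adjMat F) := by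
  simp only [FinGraph.encode, code, adjMat, List.map_ofFn, Function.comp_def]

theorem encodeGraphs_eq_code (Fs : List FinGraph) : encodeGraphs Fs = code (Fs.map adjMat) := by
  rw [encodeGraphs, List.map_congr_left fun F _ => encode_eq_code F]
  change _ = ConsTree.ofList _
  rw [List.map_map]
  rfl

/-- A maximum subforest exists. -/
theorem exists_isMaximumSubforest {Fs : List FinGraph} (hFs : Fs ≠ []) {H : FinGraph}
    (hH : IsSubforest Fs H) : ∃ H', IsMaximumSubforest Fs H' := by
  obtain ⟨F, hF⟩ := List.exists_mem_of_ne_nil Fs hFs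
  let S : Set ℕ := {k | ∃ H, IsSubforest Fs H ∧ H.order = k}
  have hbdd : BddAbove S := by
    refine ⟨F.order, ?_⟩
    rintro _ ⟨H, hH, rfl⟩
    obtain ⟨f⟩ := hH.2 F hF
    simpa using Fintype.card_le_of_injective f f.injective
  obtain ⟨H', hH', e⟩ := Nat.sSup_mem (s := S) ⟨_, H, hH, rfl⟩ hbdd
  exact ⟨H', hH', fun K hK => (le_csSup hbdd ⟨K, hK, rfl⟩).trans_eq e.symm⟩

/-- The result of the algorithm is a subforest. -/
theorem isSubforest_outGraph {c : ℕ} (hc : 1 ≤ c) {Fs : List FinGraph} (hFs : Fs ≠ [])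
    (hac : ∀ F ∈ Fs, F.graph.IsAcyclic) :
    IsSubforest Fs (outGraph (bestCommon c (Fs.map adjMat))) := by
  have hall : ∀ F ∈ Fs, (outGraph (bestCommon c (Fs.map adjMat))).graph.IsIndContained F.graph := by
    intro F hF
    -- The chosen vector is either the start value zero, realized by the empty packing, or feasible
    -- for every member.
    rcases List.mem_cons.1 (foldl_best_spec ((Fs.map adjMat).foldl (restrict c)
      (feasible c ((Fs.map adjMat).headD []))) 0).1 with h | h
    · have := (Pack.nil (G := F.graph) (c := c)).outGraph.1
      rw [multVec_nil] at this
      rw [bestCommon, bestOf, h]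
      exact this
    · obtain ⟨L, W, hP, e⟩ := exists_pack_of_mem_feasible hc (hac F hF)
        ((mem_foldl_restrict.1 h).2 _ (List.mem_map_of_mem hF))
      have := hP.outGraph.1
      rw [← e] at this
      exact this
  obtain ⟨F, hF⟩ := List.exists_mem_of_ne_nil Fs hFs
  obtain ⟨f⟩ := hall F hF
  exact ⟨(hac F hF).embedding f, hall⟩

/-- The result of the algorithm is nearly as large as any subforest. -/
theorem le_order_outGraph {c : ℕ} (hc : 1 ≤ c) {Fs : List FinGraph} (hFs : Fs ≠ [])
    (hac : ∀ F ∈ Fs, F.graph.IsAcyclic) {H : FinGraph} (hH : IsSubforest Fs H) :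
    c * H.order ≤ (c + 1) * (outGraph (bestCommon c (Fs.map adjMat))).order := by
  -- The subforest `H` is cut into small components. Each member contains `H` as an induced
  -- subgraph, so the resulting multiplicities are feasible for all members and compete for the
  -- maximum.
  obtain ⟨L, W, hP, hcard⟩ := exists_pack hH.1 hc
  rw [Fintype.card_fin] at hcard
  refine hcard.trans (Nat.mul_le_mul_left _ ?_)
  rw [← hP.outGraph.2]
  have hmem : ∀ F ∈ Fs, multVec c L ∈ feasible c (adjMat F) := by
    intro F hF
    obtain ⟨f⟩ := hH.2 F hF
    exact multVec_mem_feasible hc (hac F hF) (hP.map (LocalIso.of_embedding f W))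
  refine (foldl_best_spec _ 0).2 _ (List.mem_cons_of_mem _ (mem_foldl_restrict.2 ⟨?_, ?_⟩))
  · cases Fs with
    | nil => exact absurd rfl hFs
    | cons F Fs => exact hmem F (by simp)
  · intro M hM
    obtain ⟨F, hF, rfl⟩ := List.mem_map.1 hM
    exact hmem F hF

theorem exists_bound {g : ℕ → ℕ} (hg : PolyBdd g) : ∃ C p, ∀ n, 1 ≤ n →
    g (n * (n * 4 + 2) + 1) ≤ C * n ^ p := by
  obtain ⟨C, p, h⟩ := hg
  -- The unary code of `4n² + 2n + 1` has size `8n² + 4n + 3`, which is at most `15n²` for `n ≥ 1`.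
  refine ⟨C * 15 ^ p, 2 * p, fun n hn => (h _).trans ?_⟩
  rw [mul_assoc, pow_mul, ← mul_pow, tsize_nat]
  exact Nat.mul_le_mul_left _ (Nat.pow_le_pow_left (by nlinarith) _)

end MaxSubforest

open MaxSubforest in
/-- Maximum Subforest has a polynomial time approximation scheme: for every `ε > 0` there are an
exponent `p`, a program `P` and a constant `C` such that, for every list `Fs` of `k ≥ 1` forests of
order at most `n` (with `n ≥ 1`), `P` outputs in time at most `C * (k * n ^ p)` a subforest `F` of
`Fs` with `n(F) ≥ (1 - ε) n(Fopt)` for a maximum subforest `Fopt` of `Fs`. -/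
theorem theorem4 (ε : ℝ) (hε : 0 < ε) :
    ∃ (p : ℕ) (P : WhileCmd) (C : ℕ), ∀ (Fs : List FinGraph) (n : ℕ),
      Fs ≠ [] → 1 ≤ n → (∀ F ∈ Fs, F.graph.IsAcyclic ∧ F.order ≤ n) →
      ∃ (F : FinGraph) (t : ℕ),
        P.OutputsIn (encodeGraphs Fs) F.encode t ∧
        t ≤ C * (Fs.length * n ^ p) ∧
        IsSubforest Fs F ∧
        ∃ Fopt : FinGraph, IsMaximumSubforest Fs Fopt ∧
          (F.order : ℝ) ≥ (1 - ε) * (Fopt.order : ℝ) := by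
  obtain ⟨c, hc, hcε⟩ : ∃ c : ℕ, 1 ≤ c ∧ 1 ≤ ε * (c + 1) := by
    refine ⟨⌈1 / ε⌉₊, Nat.ceil_pos.2 (by positivity), ?_⟩
    have h1 := Nat.le_ceil (1 / ε)
    have h2 : ε * (1 / ε) = 1 := mul_one_div_cancel hε.ne'
    nlinarith
  obtain ⟨P, g, hg, hP⟩ := exists_program c
  obtain ⟨C, p, hC⟩ := exists_bound hg
  refine ⟨p, P, C, fun Fs n hFs hn hF => ?_⟩
  have hac : ∀ F ∈ Fs, F.graph.IsAcyclic := fun F h => (hF F h).1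
  obtain ⟨t, hrun, ht⟩ := hP (Fs.map adjMat) _ (by simpa using hFs) (fun M hM => by
    obtain ⟨F, h, rfl⟩ := List.mem_map.1 hM
    exact tsize_adjMat_le (hF F h).2)
  have hsub := isSubforest_outGraph hc hFs hac
  obtain ⟨Fopt, hopt⟩ := exists_isMaximumSubforest hFs hsub
  refine ⟨_, t, ?_, ?_, hsub, Fopt, hopt, ?_⟩
  · rwa [encodeGraphs_eq_code, encode_eq_code, adjMat_outGraph]
  · rw [List.length_map] at ht
    refine ht.trans ((Nat.mul_le_mul_left _ (hC n hn)).trans_eq ?_)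
    ring
  · have h := le_order_outGraph hc hFs hac hopt.1
    have h' : (c : ℝ) * Fopt.order ≤
        (c + 1) * (outGraph (bestCommon c (Fs.map adjMat))).order := by exact_mod_cast h
    have h0 : (0 : ℝ) ≤ Fopt.order := Nat.cast_nonneg _
    have hpos : (0 : ℝ) < c + 1 := by positivity
    refine le_of_mul_le_mul_left ?_ hpos
    -- Here `c = (c + 1) - 1`, and the lost term is absorbed by `Fopt.order ≤ ε (c + 1) Fopt.order`.
    nlinarith [mul_le_mul_of_nonneg_right hcε h0]
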